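/- Let $n\ge 2$, $1\le k\le n-1$, let $I=[a,b]$ with $a<b$, and let $\sigma=\{\sigma_1<\dots<\sigma_k\}$ and $\varepsilon=\{\varepsilon_1<\dots<\varepsilon_{n-k}\}$ be subsets of $\{0,\dots,n-1\}$ satisfying condition $(N_a)$: $$\sum_{\sigma_j<h}1+\sum_{\varepsilon_j<h}1\ \ge\ h\qquad\text{for all }h\in\{1,\dots,n-1\}.$$ A Green's function of $u^{(n)}$ with the boundary conditions $u^{(\sigma_1)}(a)=\dots=u^{(\sigma_k)}(a)=0$, $u^{(\varepsilon_1)}(b)=\dots=u^{(\varepsilon_{n-k})}(b)=0$ is a function $g_0(t,s)$ which is of class $C^{n-2}$ on $I\times I$ and of class $C^n$ on each of the triangles $a\le s<t\le b$ and $a\le t<s\le b$, and such that for every $s\in(a,b)$: $\frac{\partial^n}{\partial t^n}g_0(t,s)=0$ for $t\in I\setminus\{s\}$; the one-sided limits of $\frac{\partial^{n-1}}{\partial t^{n-1}}g_0(t,s)$ as $t\to s^{\pm}$ exist and satisfy $\frac{\partial^{n-1}}{\partial t^{n-1}}g_0(s^+,s)=\frac{\partial^{n-1}}{\partial t^{n-1}}g_0(s^-,s)+1$;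 and $g_0(\cdot,s)$ satisfies the boundary conditions. Let $q\in\{1,\dots,n-1\}$. For $s\in(a,b)$ write $v_s^h(t)=\frac{\partial^h}{\partial t^h}g_0(t,s)$. Let $c_q$ and $d_q$ be the cardinalities of $\{\sigma_j-q\}\cap\{0,\dots,n-q-1\}$ and $\{\varepsilon_j-q\}\cap\{0,\dots,n-q-1\}$. Let $\mu^q$ be the set obtained from $\sigma$ by replacing each $\sigma_j$ by $\sigma_j-q$ if $\sigma_j\ge q$ and by $\sigma_j-q+n$ if $\sigma_j<q$; let $\rho^q$ be obtained from $\varepsilon$ in the same way; and put $\alpha^q=\min(\{0,\dots,n-1\}\setminus\mu^q)$, $\beta^q=\min(\{0,\dots,n-1\}\setminus\rho^q)$. We say that $v_s^q$ is strongly positive (strongly negative) on $I\times I$ if for every $s\in(a,b)$ one has $v_s^q(t)>0$ ($<0$) for a.e. $t\in(a,b)$, and for a.e. $s\in(a,b)$ one has $(v_s^q)^{(\alpha^q)}(a)>0$ ($<0$), and for a.e. $s\in(a,b)$ one has $(-1)^{\beta^q}(v_s^q)^{(\beta^q)}(b)>0$ ($<0$). **Theorem.** Suppose that $(N_a)$ holds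 and $c_q+d_q=n-q$. Then a Green's function $g_0$ exists, and every such $g_0$ has the following properties. (a) If $c_q\ge1$ and $d_q\ge1$, then $v_s^q$ is strongly positive on $I\times I$ if $n-q-c_q$ is even, and strongly negative on $I\times I$ if $n-q-c_q$ is odd. (b) If $c_q=n-q$ and $d_q=0$, then for every $s\in(a,b)$: $v_s^q(t)>0,\dots,v_s^{n-1}(t)>0$ for $t\in(s,b]$; $v_s^q(t)=\dots=v_s^{n-2}(t)=0$ for $t\in[a,s]$ (no condition if $q=n-1$); and $v_s^{n-1}(t)=0$ for $t\in[a,s)$. (c) If $c_q=0$ and $d_q=n-q$, then for every $s\in(a,b)$: $v_s^q(t)>0$ for $t\in[a,s)$ if $q=n-l$ with $l$ even, and $v_s^q(t)<0$ for $t\in[a,s)$ if $q=n-l$ with $l$ odd; moreover $v_s^q(t)=\dots=v_s^{n-2}(t)=0$ for $t\in[s,b]$ (no condition if $q=n-1$), and $v_s^{n-1}(t)=0$ for $t\in(s,b]$. -/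

import Mathlib

open Set Filter Topology MeasureTheory

/-- Property `(N_a)` for the index sets `σ` (conditions at `a`) and `ε` (conditions at `b`). -/
def PropertyNa (n : ℕ) (σ ε : Finset ℕ) : Prop :=
  ∀ h : ℕ, 1 ≤ h → h ≤ n - 1 →
    h ≤ (σ.filter (fun j => j < h)).card + (ε.filter (fun j => j < h)).card

/-- `∂^h g / ∂t^h (t, s)`, where `g t s` is defined on `[a, b] × [a, b]`;
the derivatives are one-sided at `t = a` and `t = b`. -/
noncomputable def partialT (a b : ℝ) (g : ℝ → ℝ → ℝ) (h : ℕ) (s t : ℝ) : ℝ :=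
  iteratedDerivWithin h (fun x => g x s) (Icc a b) t

/-- `g` is the Green's function of the operator `T_n[M] u = u^(n) + M u` on `[a, b]` with the
boundary conditions `u^(i)(a) = 0` for `i ∈ σ` and `u^(i)(b) = 0` for `i ∈ ε` (here `n ≥ 2`). -/
structure IsGreenFunction (n : ℕ) (M : ℝ) (σ ε : Finset ℕ) (a b : ℝ) (g : ℝ → ℝ → ℝ) : Prop where
  /-- `g` is of class `C^(n-2)` on the closed square. -/
  contDiffOn_square :
    ContDiffOn ℝ ((n - 2 : ℕ) : ℕ∞) (fun p : ℝ × ℝ => g p.1 p.2) (Icc a b ×ˢ Icc a b)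
  /-- `g` is of class `C^n` on the triangle `a ≤ s < t ≤ b`. -/
  contDiffOn_lower :
    ContDiffOn ℝ (n : ℕ∞) (fun p : ℝ × ℝ => g p.1 p.2) {p | a ≤ p.2 ∧ p.2 < p.1 ∧ p.1 ≤ b}
  /-- `g` is of class `C^n` on the triangle `a ≤ t < s ≤ b`. -/
  contDiffOn_upper :
    ContDiffOn ℝ (n : ℕ∞) (fun p : ℝ × ℝ => g p.1 p.2) {p | a ≤ p.1 ∧ p.1 < p.2 ∧ p.2 ≤ b}
  /-- `g(·, s)` solves the homogeneous equation off the diagonal. -/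
  equation : ∀ s ∈ Ioo a b, ∀ t ∈ Icc a b, t ≠ s → partialT a b g n s t + M * g t s = 0
  /-- The derivative of order `n - 1` has a jump of height `1` on the diagonal. -/
  jump : ∀ s ∈ Ioo a b, ∃ l : ℝ,
    Tendsto (partialT a b g (n - 1) s) (𝓝[<] s) (𝓝 l) ∧
    Tendsto (partialT a b g (n - 1) s) (𝓝[>] s) (𝓝 (l + 1))
  /-- Boundary conditions at `a`. -/
  boundary_left : ∀ s ∈ Ioo a b, ∀ i ∈ σ, partialT a b g i s a = 0
  /-- Boundary conditions at `b`. -/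
  boundary_right : ∀ s ∈ Ioo a b, ∀ i ∈ ε, partialT a b g i s b = 0

/-- The index set `{j - q : j ∈ S} ∩ {0, …, n - q - 1}` (differences taken in `ℤ`). -/
def truncIndices (n q : ℕ) (S : Finset ℕ) : Finset ℕ :=
  (Finset.range (n - q)).filter (fun i => i + q ∈ S)

/-- The index set obtained from `S ⊆ {0, …, n - 1}` by replacing each `j ∈ S` by `j - q` if
`j ≥ q` and by `j - q + n` if `j < q`. It indexes the boundary conditions of the derivative of
order `q`. -/
def cyclicIndices (n q : ℕ) (S : Finset ℕ) : Finset ℕ :=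
  (Finset.range n).filter (fun i => (i + q) % n ∈ S)

/-- The least `i ∈ {0, …, n - 1}` with `i ∉ S`. -/
noncomputable def leastMissing (n : ℕ) (S : Finset ℕ) : ℕ :=
  sInf {i : ℕ | i < n ∧ i ∉ S}

/-- `v_s^q = ∂^q g / ∂t^q (·, s)` is strongly positive on `[a, b] × [a, b]`. -/
def StronglyPositive (n : ℕ) (σ ε : Finset ℕ) (a b : ℝ) (g : ℝ → ℝ → ℝ) (q : ℕ) : Prop :=
  (∀ s ∈ Ioo a b, ∀ᵐ t ∂(volume.restrict (Ioo a b)), 0 < partialT a b g q s t) ∧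
  (∀ᵐ s ∂(volume.restrict (Ioo a b)),
    0 < iteratedDerivWithin (leastMissing n (cyclicIndices n q σ))
      (partialT a b g q s) (Icc a b) a) ∧
  (∀ᵐ s ∂(volume.restrict (Ioo a b)),
    0 < (-1) ^ leastMissing n (cyclicIndices n q ε) *
      iteratedDerivWithin (leastMissing n (cyclicIndices n q ε))
        (partialT a b g q s) (Icc a b) b)

/-- `v_s^q = ∂^q g / ∂t^q (·, s)` is strongly negative on `[a, b] × [a, b]`. -/
def StronglyNegative (n : ℕ) (σ ε : Finset ℕ) (a b : ℝ) (g : ℝ → ℝ → ℝ) (q : ℕ) : Prop :=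
  (∀ s ∈ Ioo a b, ∀ᵐ t ∂(volume.restrict (Ioo a b)), partialT a b g q s t < 0) ∧
  (∀ᵐ s ∂(volume.restrict (Ioo a b)),
    iteratedDerivWithin (leastMissing n (cyclicIndices n q σ))
      (partialT a b g q s) (Icc a b) a < 0) ∧
  (∀ᵐ s ∂(volume.restrict (Ioo a b)),
    (-1) ^ leastMissing n (cyclicIndices n q ε) *
      iteratedDerivWithin (leastMissing n (cyclicIndices n q ε))
        (partialT a b g q s) (Icc a b) b < 0)

/-! For fixed `s`, the functions `v_s^q, v_s^{q+1}, …` are successive derivatives of a spline with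
the single knot `s`. The proof counts sign alternations, in the manner of Rolle. Passing from a
function to its derivative costs one alternation and regains one for each boundary zero; a zero at
`b` also reverses the sign at the last point. Since `c_q + d_q = n - q`, exactly `q` conditions have
order below `q`, so `(N_a)` says that the count starting at order `q` never runs out before order
`n`. The derivative of order `n - 1` is a step function with jump `+1`, hence monotone, and the
constant `1` can serve as its derivative.

Start from one point where `v_s^q ≠ 0`: at order `n` one alternation is left, so the sign of `v_s^q`
there is `(-1)^{d_q}` (`sign_mul_pos`). One more boundary zero would leave two alternations of the
constant `1`, which is absurd. Hence the first derivatives not prescribed at the endpoints are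
nonzero, and the mean value theorem near the endpoints gives their signs. The zeros of `v_s^q` form
a null set: identical vanishing on one side of the knot makes it a truncated power on the other
side, contradicting a condition at the far endpoint.

In cases (b) and (c) all conditions of order at least `q` lie at one endpoint, so `v_s^q` is itself
a truncated power, up to sign. For existence, the same count shows that the boundary value problem
for polynomials of degree `< n` is uniquely solvable; such a polynomial corrects `(t - s)_+^{n-1} /
(n-1)!`. -/

/-! ### Sign alternations under differentiation -/

/-- There are `L` points in `(a, c)` at which `f` has alternating strict signs, and the sign at the
largest of them is that of `e`. -/
def Alternates (f : ℝ → ℝ) (a : ℝ) : ℕ → ℝ → ℝ → Prop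
  | 0, _, _ => True
  | L + 1, e, c => ∃ t ∈ Ioo a c, 0 < e * f t ∧ Alternates f a L (-e) t

theorem Alternates.mono {f : ℝ → ℝ} {a : ℝ} {L : ℕ} {e c d : ℝ} (h : Alternates f a L e c)
    (hcd : c ≤ d) : Alternates f a L e d := by
  cases L with
  | zero => trivial
  | succ L =>
    obtain ⟨t, ht, h1, h2⟩ := h
    exact ⟨t, ⟨ht.1, ht.2.trans_le hcd⟩, h1, h2⟩

/-- A mean value property linking `f` to its (generalised) derivative `f'`. -/
def HasSlope (a b : ℝ) (f f' : ℝ → ℝ) : Prop :=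
  ∀ x ∈ Icc a b, ∀ y ∈ Icc a b, x < y → ∀ e : ℝ, e * f x < e * f y → ∃ τ ∈ Ioo x y, 0 < e * f' τ

/-- Between two consecutive points of opposite sign the slope has the sign of the right-hand one, so
the top sign is kept. -/
theorem HasSlope.alternates {a b : ℝ} {f f' : ℝ → ℝ} (h : HasSlope a b f f') :
    ∀ (L : ℕ) (e t : ℝ), t ∈ Ioo a b → 0 < e * f t → Alternates f a L (-e) t →
      Alternates f' a L e t := by
  intro L
  induction L with
  | zero => intros; trivial
  | succ L ih =>
    rintro e t ht hpos ⟨u, hu, h1, h2⟩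
    have hub : u ∈ Ioo a b := ⟨hu.1, hu.2.trans ht.2⟩
    obtain ⟨τ, hτ, h3⟩ := h u (Ioo_subset_Icc_self hub) t (Ioo_subset_Icc_self ht) hu.2 e
      (by linarith)
    exact ⟨τ, ⟨hu.1.trans hτ.1, hτ.2⟩, h3, (ih (-e) u hub h1 h2).mono hτ.1.le⟩

/-- The zero at `a` acts as one more point below the lowest one, which makes up for the lost
alternation. -/
theorem HasSlope.alternates_of_left_zero {a b : ℝ} {f f' : ℝ → ℝ} (h : HasSlope a b f f')
    (ha : f a = 0) :
    ∀ (L : ℕ) (e t : ℝ), t ∈ Ioo a b → 0 < e * f t → Alternates f a L (-e) t →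
      Alternates f' a (L + 1) e t := by
  intro L
  induction L with
  | zero =>
    intro e t ht hpos _
    obtain ⟨τ, hτ, h3⟩ := h a ⟨le_rfl, (ht.1.trans ht.2).le⟩ t (Ioo_subset_Icc_self ht) ht.1 e
      (by rw [ha]; linarith)
    exact ⟨τ, hτ, h3, trivial⟩
  | succ L ih =>
    rintro e t ht hpos ⟨u, hu, h1, h2⟩
    have hub : u ∈ Ioo a b := ⟨hu.1, hu.2.trans ht.2⟩
    obtain ⟨τ, hτ, h3⟩ := h u (Ioo_subset_Icc_self hub) t (Ioo_subset_Icc_self ht) hu.2 e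
      (by linarith)
    exact ⟨τ, ⟨hu.1.trans hτ.1, hτ.2⟩, h3, (ih (-e) u hub h1 h2).mono hτ.1.le⟩

/-- Passing from `f` to `f'` loses one alternation and gains one for each boundary zero of `f`. -/
theorem HasSlope.alternates_boundary {a b : ℝ} {f f' : ℝ → ℝ} (h : HasSlope a b f f')
    {p r : Prop} [Decidable p] [Decidable r] (hp : p → f a = 0) (hr : r → f b = 0)
    {L : ℕ} {e : ℝ} (hf : Alternates f a (L + 1) e b) :
    Alternates f' a (L + (if p then 1 else 0) + (if r then 1 else 0))
      (e * (-1) ^ (if r then 1 else 0)) b := by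
  obtain ⟨t, ht, h1, h2⟩ := hf
  have key : Alternates f' a (L + (if p then 1 else 0)) e t := by
    split_ifs with h0
    · exact h.alternates_of_left_zero (hp h0) L e t ht h1 h2
    · exact h.alternates L e t ht h1 h2
  by_cases hr0 : r
  · simp only [hr0, if_true, pow_one, mul_neg, mul_one]
    -- From `t` to the zero at `b` the function returns to `0`. This adds a new top point, of sign
    -- `-e`.
    obtain ⟨τ, hτ, h3⟩ := h t (Ioo_subset_Icc_self ht) b ⟨(ht.1.trans ht.2).le, le_rfl⟩ ht.2 (-e)
      (by rw [hr hr0]; linarith)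
    refine ⟨τ, ⟨ht.1.trans hτ.1, hτ.2⟩, h3, ?_⟩
    rw [neg_neg]
    exact key.mono hτ.1.le
  · simpa [hr0] using key.mono ht.2.le

/-! ### Counting boundary conditions along a chain of derivatives -/

/-- The number of elements of `S` in `[q, h)`. -/
def countIco (S : Finset ℕ) (q h : ℕ) : ℕ := (S.filter (fun j => q ≤ j ∧ j < h)).card

theorem countIco_self (S : Finset ℕ) (q : ℕ) : countIco S q q = 0 := by
  simp only [countIco, Finset.card_eq_zero, Finset.filter_eq_empty_iff]
  intros; omega

theorem countIco_succ (S : Finset ℕ) {q h : ℕ} (hqh : q ≤ h) :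
    countIco S q (h + 1) = countIco S q h + if h ∈ S then 1 else 0 := by
  unfold countIco
  split_ifs with hS
  · rw [← Finset.card_insert_of_notMem (a := h) (by simp)]
    congr 1
    ext j
    simp only [Finset.mem_filter, Finset.mem_insert]
    constructor
    · rintro ⟨h1, h2, h3⟩
      by_cases hj : j = h
      · exact Or.inl hj
      · exact Or.inr ⟨h1, h2, by omega⟩
    · rintro (rfl | ⟨h1, h2, h3⟩)
      · exact ⟨hS, hqh, by omega⟩
      · exact ⟨h1, h2, by omega⟩
  · rw [add_zero]
    congr 1
    ext j
    simp only [Finset.mem_filter]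
    constructor
    · rintro ⟨h1, h2, h3⟩
      have : j ≠ h := fun hj => hS (hj ▸ h1)
      exact ⟨h1, h2, by omega⟩
    · rintro ⟨h1, h2, h3⟩
      exact ⟨h1, h2, by omega⟩

theorem countIco_add (S : Finset ℕ) {q h : ℕ} (hqh : q ≤ h) :
    countIco S 0 h = countIco S 0 q + countIco S q h := by
  induction h, hqh using Nat.le_induction with
  | base => simp [countIco_self]
  | succ h hqh ih => rw [countIco_succ S hqh, countIco_succ S (Nat.zero_le h), ih, add_assoc]

theorem countIco_insert {S : Finset ℕ} {i : ℕ} (hi : i ∉ S) (q h : ℕ) :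
    countIco (insert i S) q h = countIco S q h + if q ≤ i ∧ i < h then 1 else 0 := by
  unfold countIco
  rw [Finset.filter_insert]
  split_ifs with h1
  · rw [Finset.card_insert_of_notMem]
    simp [hi]
  · simp

/-- Counting alternations along a chain of generalised derivatives with boundary zeros indexed by
`A` (at `a`) and `B` (at `b`). -/
theorem alternates_chain {a b : ℝ} {F : ℕ → ℝ → ℝ} {q m : ℕ} {A B : Finset ℕ}
    (hslope : ∀ j, q ≤ j → j < m → HasSlope a b (F j) (F (j + 1)))
    (hA : ∀ j ∈ A, q ≤ j → j < m → F j a = 0) (hB : ∀ j ∈ B, q ≤ j → j < m → F j b = 0)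
    (hcount : ∀ h, q ≤ h → h < m → h ≤ q + countIco A q h + countIco B q h)
    {e t : ℝ} (ht : t ∈ Ioo a b) (het : 0 < e * F q t) {h : ℕ} (hqh : q ≤ h) (hhm : h ≤ m) :
    Alternates (F h) a (1 + q + countIco A q h + countIco B q h - h)
      (e * (-1) ^ countIco B q h) b := by
  induction h, hqh using Nat.le_induction with
  | base =>
    have : 1 + q + countIco A q q + countIco B q q - q = 0 + 1 := by
      rw [countIco_self, countIco_self]; omega
    rw [this, countIco_self, pow_zero, mul_one]
    exact ⟨t, ht, het, trivial⟩
  | succ h hqh ih =>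
    have h1 := ih (by omega)
    have h2 := hcount h hqh (by omega)
    -- `hcount` guarantees that at least one alternation is present at order `h`, so the subtraction
    -- does not truncate and another derivative can be taken.
    obtain ⟨L, hL⟩ : ∃ L, 1 + q + countIco A q h + countIco B q h - h = L + 1 :=
      ⟨q + countIco A q h + countIco B q h - h, by omega⟩
    rw [hL] at h1
    have h3 := (hslope h hqh (by omega)).alternates_boundary (p := h ∈ A) (r := h ∈ B)
      (fun h' => hA h h' hqh (by omega)) (fun h' => hB h h' hqh (by omega)) h1
    rw [countIco_succ A hqh, countIco_succ B hqh, pow_add, ← mul_assoc]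
    convert h3 using 1
    omega

theorem exists_mul_pos_of_slope {f f' : ℝ → ℝ} {x y e : ℝ} (hxy : x < y)
    (hc : ContinuousOn f (Icc x y)) (hd : ∀ t ∈ Ioo x y, HasDerivAt f (f' t) t)
    (he : e * f x < e * f y) : ∃ τ ∈ Ioo x y, 0 < e * f' τ := by
  obtain ⟨τ, hτ, h⟩ := exists_hasDerivAt_eq_slope f f' hxy hc hd
  refine ⟨τ, hτ, ?_⟩
  rw [h, ← mul_div_assoc]
  exact div_pos (by linarith) (by linarith)

/-- A continuous function that is differentiable off one point has the mean value property. -/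
theorem hasSlope_of_hasDerivAt {a b s : ℝ} {f f' : ℝ → ℝ} (hc : ContinuousOn f (Icc a b))
    (hd : ∀ t ∈ Ioo a b, t ≠ s → HasDerivAt f (f' t) t) : HasSlope a b f f' := by
  intro x hx y hy hxy e he
  by_cases hs : s ∈ Ioo x y
  · rcases lt_or_ge (e * f x) (e * f s) with h | h
    · obtain ⟨τ, hτ, h1⟩ := exists_mul_pos_of_slope (f' := f') hs.1
        (hc.mono (Icc_subset_Icc hx.1 (hs.2.le.trans hy.2)))
        (fun t ht => hd t ⟨hx.1.trans_lt ht.1, (ht.2.trans hs.2).trans_le hy.2⟩ ht.2.ne) h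
      exact ⟨τ, ⟨hτ.1, hτ.2.trans hs.2⟩, h1⟩
    · obtain ⟨τ, hτ, h1⟩ := exists_mul_pos_of_slope (f' := f') hs.2
        (hc.mono (Icc_subset_Icc (hx.1.trans hs.1.le) hy.2))
        (fun t ht => hd t ⟨hx.1.trans_lt (hs.1.trans ht.1), ht.2.trans_le hy.2⟩ ht.1.ne')
        (h.trans_lt he)
      exact ⟨τ, ⟨hs.1.trans hτ.1, hτ.2⟩, h1⟩
  · exact exists_mul_pos_of_slope hxy (hc.mono (Icc_subset_Icc hx.1 hy.2))
      (fun t ht => hd t ⟨hx.1.trans_lt ht.1, ht.2.trans_le hy.2⟩ (fun h => hs (h ▸ ht))) he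

/-- Monotone functions have the mean value property with derivative replaced by `1`. -/
theorem Monotone.hasSlope {f : ℝ → ℝ} (hf : Monotone f) (a b : ℝ) :
    HasSlope a b f (fun _ => 1) := by
  intro x _ y _ hxy e he
  obtain ⟨τ, hτ⟩ := exists_between hxy
  refine ⟨τ, hτ, ?_⟩
  have := hf hxy.le
  by_contra h
  nlinarith

/-! ### Splines with one knot -/

/-- `F 0, …, F (n - 1)` are the successive derivatives on `[a, b]` of a spline of degree `n - 1`
with a single knot `s`, where `F (n - 1)` jumps from `l` to `l + 1`. -/
structure IsJumpSpline (n : ℕ) (a b s l : ℝ) (F : ℕ → ℝ → ℝ) : Prop where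
  two_le : 2 ≤ n
  knot : s ∈ Ioo a b
  cont : ∀ j, j + 2 ≤ n → ContinuousOn (F j) (Icc a b)
  deriv : ∀ j, j + 2 ≤ n → ∀ t ∈ Ioo a b, t ≠ s → HasDerivAt (F j) (F (j + 1) t) t
  left : ∀ t ∈ Ico a s, F (n - 1) t = l
  right : ∀ t ∈ Ioc s b, F (n - 1) t = l + 1

namespace IsJumpSpline

variable {n : ℕ} {a b s l : ℝ} {F : ℕ → ℝ → ℝ}

theorem exists_sub_eq_left (h : IsJumpSpline n a b s l F) {j : ℕ} (hj : j + 2 ≤ n) {x y : ℝ}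
    (hx : a ≤ x) (hxy : x < y) (hy : y ≤ s) :
    ∃ τ ∈ Ioo x y, F j y - F j x = F (j + 1) τ * (y - x) := by
  obtain ⟨τ, hτ, h1⟩ := exists_hasDerivAt_eq_slope (F j) (F (j + 1)) hxy
    ((h.cont j hj).mono (Icc_subset_Icc hx (hy.trans h.knot.2.le)))
    (fun t ht => h.deriv j hj t ⟨hx.trans_lt ht.1, (ht.2.trans_le hy).trans h.knot.2⟩
      (ht.2.trans_le hy).ne)
  refine ⟨τ, hτ, ?_⟩
  rw [h1, div_mul_cancel₀]
  linarith

theorem exists_sub_eq_right (h : IsJumpSpline n a b s l F) {j : ℕ} (hj : j + 2 ≤ n) {x y : ℝ}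
    (hx : s ≤ x) (hxy : x < y) (hy : y ≤ b) :
    ∃ τ ∈ Ioo x y, F j y - F j x = F (j + 1) τ * (y - x) := by
  obtain ⟨τ, hτ, h1⟩ := exists_hasDerivAt_eq_slope (F j) (F (j + 1)) hxy
    ((h.cont j hj).mono (Icc_subset_Icc (h.knot.1.le.trans hx) hy))
    (fun t ht => h.deriv j hj t ⟨(h.knot.1.trans_le hx).trans ht.1, ht.2.trans_le hy⟩
      (hx.trans_lt ht.1).ne')
  refine ⟨τ, hτ, ?_⟩
  rw [h1, div_mul_cancel₀]
  linarith

/-- Vanishing of all derivatives at `a` forces vanishing up to the knot. -/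
theorem eq_zero_left (h : IsJumpSpline n a b s l F) {q : ℕ} (hl : l = 0)
    (ha : ∀ j, q ≤ j → j + 2 ≤ n → F j a = 0) :
    ∀ j, q ≤ j → j + 2 ≤ n → ∀ t ∈ Icc a s, F j t = 0 := by
  have key : ∀ d j, j + 2 + d = n → q ≤ j → ∀ t ∈ Icc a s, F j t = 0 := by
    intro d
    induction d with
    | zero =>
      intro j hj hq t ht
      rcases ht.1.eq_or_lt with rfl | hat
      · exact ha j hq (by omega)
      · obtain ⟨τ, hτ, h1⟩ := h.exists_sub_eq_left (j := j) (by omega) le_rfl hat ht.2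
        rw [ha j hq (by omega), show j + 1 = n - 1 by omega,
          h.left τ ⟨hτ.1.le, hτ.2.trans_le ht.2⟩, hl] at h1
        linarith
    | succ d ih =>
      intro j hj hq t ht
      rcases ht.1.eq_or_lt with rfl | hat
      · exact ha j hq (by omega)
      · obtain ⟨τ, hτ, h1⟩ := h.exists_sub_eq_left (j := j) (by omega) le_rfl hat ht.2
        rw [ha j hq (by omega),
          ih (j + 1) (by omega) (by omega) τ ⟨hτ.1.le, (hτ.2.trans_le ht.2).le⟩] at h1
        linarith
  intro j hq hj
  exact key (n - (j + 2)) j (by omega) hq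

/-- Vanishing of all derivatives at `b` forces vanishing down to the knot. -/
theorem eq_zero_right (h : IsJumpSpline n a b s l F) {q : ℕ} (hl : l + 1 = 0)
    (hb : ∀ j, q ≤ j → j + 2 ≤ n → F j b = 0) :
    ∀ j, q ≤ j → j + 2 ≤ n → ∀ t ∈ Icc s b, F j t = 0 := by
  have key : ∀ d j, j + 2 + d = n → q ≤ j → ∀ t ∈ Icc s b, F j t = 0 := by
    intro d
    induction d with
    | zero =>
      intro j hj hq t ht
      rcases ht.2.eq_or_lt with rfl | htb
      · exact hb j hq (by omega)
      · obtain ⟨τ, hτ, h1⟩ := h.exists_sub_eq_right (j := j) (by omega) ht.1 htb le_rfl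
        rw [hb j hq (by omega), show j + 1 = n - 1 by omega,
          h.right τ ⟨ht.1.trans_lt hτ.1, hτ.2.le⟩, hl] at h1
        linarith
    | succ d ih =>
      intro j hj hq t ht
      rcases ht.2.eq_or_lt with rfl | htb
      · exact hb j hq (by omega)
      · obtain ⟨τ, hτ, h1⟩ := h.exists_sub_eq_right (j := j) (by omega) ht.1 htb le_rfl
        rw [hb j hq (by omega),
          ih (j + 1) (by omega) (by omega) τ ⟨(ht.1.trans_lt hτ.1).le, hτ.2.le⟩] at h1
        linarith
  intro j hq hj
  exact key (n - (j + 2)) j (by omega) hq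

/-- If the spline vanishes at the knot to maximal order and has `l = 0`, its derivatives are
positive to the right of the knot. -/
theorem pos_right (h : IsJumpSpline n a b s l F) {q : ℕ} (hl : l = 0)
    (hs : ∀ j, q ≤ j → j + 2 ≤ n → F j s = 0) :
    ∀ j, q ≤ j → j + 1 ≤ n → ∀ t ∈ Ioc s b, 0 < F j t := by
  have key : ∀ d j, j + 1 + d = n → q ≤ j → ∀ t ∈ Ioc s b, 0 < F j t := by
    intro d
    induction d with
    | zero =>
      intro j hj hq t ht
      rw [show j = n - 1 by omega, h.right t ht, hl]
      norm_num
    | succ d ih =>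
      intro j hj hq t ht
      obtain ⟨τ, hτ, h1⟩ := h.exists_sub_eq_right (j := j) (by omega) le_rfl ht.1 ht.2
      have h2 := ih (j + 1) (by omega) (by omega) τ ⟨hτ.1, hτ.2.le.trans ht.2⟩
      rw [hs j hq (by omega), sub_zero] at h1
      rw [h1]
      exact mul_pos h2 (sub_pos.2 ht.1)
  intro j hq hj
  exact key (n - (j + 1)) j (by omega) hq

/-- If the spline vanishes at the knot to maximal order and has `l = -1`, the signs of its
derivatives alternate to the left of the knot. -/
theorem pos_left (h : IsJumpSpline n a b s l F) {q : ℕ} (hl : l + 1 = 0)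
    (hs : ∀ j, q ≤ j → j + 2 ≤ n → F j s = 0) :
    ∀ j, q ≤ j → j + 1 ≤ n → ∀ t ∈ Ico a s, 0 < (-1) ^ (n - j) * F j t := by
  have key : ∀ d j, j + 1 + d = n → q ≤ j → ∀ t ∈ Ico a s, 0 < (-1) ^ (d + 1) * F j t := by
    intro d
    induction d with
    | zero =>
      intro j hj hq t ht
      rw [show j = n - 1 by omega, h.left t ht, show l = -1 by linarith]
      norm_num
    | succ d ih =>
      intro j hj hq t ht
      obtain ⟨τ, hτ, h1⟩ := h.exists_sub_eq_left (j := j) (by omega) ht.1 ht.2 le_rfl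
      have h2 := ih (j + 1) (by omega) (by omega) τ ⟨ht.1.trans hτ.1.le, hτ.2⟩
      rw [hs j hq (by omega), zero_sub] at h1
      have h3 : (-1) ^ (d + 1 + 1) * F j t = (-1) ^ (d + 1) * F (j + 1) τ * (s - t) := by
        rw [mul_assoc, ← h1]; ring
      rw [h3]
      exact mul_pos h2 (sub_pos.2 ht.2)
  intro j hq hj
  have := key (n - (j + 1)) j (by omega) hq
  rwa [show n - (j + 1) + 1 = n - j by omega] at this

end IsJumpSpline

/-! ### Zero sets -/

/-- The zeros of a differentiable function at which the derivative does not vanish are isolated,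
hence countable. -/
theorem countable_setOf_eq_zero_of_deriv {f f' : ℝ → ℝ} {U : Set ℝ}
    (hd : ∀ t ∈ U, HasDerivAt f (f' t) t) (h : {t ∈ U | f' t = 0}.Countable) :
    {t ∈ U | f t = 0}.Countable := by
  set Z := {t ∈ U | f t = 0} with hZ
  -- A set of reals has only countably many points isolated from the right. At any other zero,
  -- difference quotients along `Z` are `0`, so the derivative vanishes.
  have h1 : {t ∈ Z | 𝓝[Z ∩ Ioi t] t = ⊥}.Countable := countable_setOfPred_isolated_right_within
  refine (h1.union h).mono fun t ht => ?_
  by_cases hb : 𝓝[Z ∩ Ioi t] t = ⊥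
  · exact Or.inl ⟨ht, hb⟩
  refine Or.inr ⟨ht.1, ?_⟩
  have : (𝓝[Z ∩ Ioi t] t).NeBot := ⟨hb⟩
  have h2 : Tendsto (slope f t) (𝓝[Z ∩ Ioi t] t) (𝓝 (f' t)) :=
    (hasDerivAt_iff_tendsto_slope.1 (hd t ht.1)).mono_left
      (nhdsWithin_mono _ fun x hx => (ne_of_gt hx.2 : x ≠ t))
  refine tendsto_nhds_unique_of_eventuallyEq h2 (tendsto_const_nhds (x := (0 : ℝ))) ?_
  filter_upwards [self_mem_nhdsWithin] with x hx
  rw [slope_def_field, hx.1.2, ht.2, sub_zero, zero_div]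

/-- On an open interval, a function with constant `m`-th derivative either vanishes identically or
has countably many zeros. -/
theorem eq_zero_or_countable {F : ℕ → ℝ → ℝ} {x y c : ℝ} {q : ℕ} :
    ∀ m, q ≤ m → (∀ j, q ≤ j → j < m → ∀ t ∈ Ioo x y, HasDerivAt (F j) (F (j + 1) t) t) →
      (∀ t ∈ Ioo x y, F m t = c) →
      (∀ t ∈ Ioo x y, F q t = 0) ∨ {t ∈ Ioo x y | F q t = 0}.Countable := by
  intro m hqm
  induction hqm using Nat.decreasingInduction with
  | self =>
    intro _ hc
    by_cases h0 : c = 0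
    · exact Or.inl fun t ht => (hc t ht).trans h0
    · refine Or.inr ?_
      convert countable_empty
      rw [eq_empty_iff_forall_notMem]
      rintro t ⟨ht, h1⟩
      exact h0 ((hc t ht).symm.trans h1)
  | of_succ q hq ih =>
    intro hd hc
    have hd0 := hd q le_rfl hq
    rcases ih (fun j hj hjm => hd j (by omega) hjm) hc with h | h
    · have hconst : ∀ u ∈ Ioo x y, ∀ v ∈ Ioo x y, F q u = F q v := by
        intro u hu v hv
        refine (convex_Ioo x y).is_const_of_fderivWithin_eq_zero (𝕜 := ℝ)
          (fun t ht => (hd0 t ht).differentiableAt.differentiableWithinAt) ?_ hu hv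
        intro t ht
        rw [fderivWithin_of_isOpen isOpen_Ioo ht, ← toSpanSingleton_deriv, (hd0 t ht).deriv, h t ht]
        simp
      by_cases h0 : ∃ u ∈ Ioo x y, F q u = 0
      · obtain ⟨u, hu, hu0⟩ := h0
        exact Or.inl fun t ht => (hconst t ht u hu).trans hu0
      · push Not at h0
        refine Or.inr ?_
        convert countable_empty
        rw [eq_empty_iff_forall_notMem]
        rintro t ⟨ht, h1⟩
        exact h0 t ht h1
    · exact Or.inr (countable_setOf_eq_zero_of_deriv hd0 h)

theorem exists_mem_Ioo_of_ae {a b x y : ℝ} {p : ℝ → Prop} (hax : a ≤ x) (hxy : x < y)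
    (hyb : y ≤ b) (h : ∀ᵐ t ∂(volume.restrict (Ioo a b)), p t) : ∃ t ∈ Ioo x y, p t := by
  have h1 : ∀ᵐ t ∂(volume.restrict (Ioo x y)), p t :=
    ae_mono (Measure.restrict_mono (Ioo_subset_Ioo hax hyb) le_rfl) h
  rw [ae_restrict_iff' measurableSet_Ioo] at h1
  by_contra! hcon
  have h2 : volume (Ioo x y) = 0 := by
    refine measure_mono_null (fun t ht => ?_) (ae_iff.1 h1)
    exact fun h3 => hcon t ht (h3 ht)
  rw [Real.volume_Ioo, ENNReal.ofReal_eq_zero] at h2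
  linarith

/-! ### Signs of jump splines -/

namespace IsJumpSpline

variable {n : ℕ} {a b s l : ℝ} {F : ℕ → ℝ → ℝ}

/-- If the spline vanishes on the left of the knot, so do its derivatives. -/
theorem eq_zero_left_of_eq_zero (h : IsJumpSpline n a b s l F) {q : ℕ}
    (h0 : ∀ t ∈ Ioo a s, F q t = 0) :
    ∀ j, q ≤ j → j + 1 ≤ n → ∀ t ∈ Ioo a s, F j t = 0 := by
  intro j hqj
  induction j, hqj using Nat.le_induction with
  | base => exact fun _ => h0
  | succ j hqj ih =>
    intro hj t ht
    have h1 := h.deriv j (by omega) t ⟨ht.1, ht.2.trans h.knot.2⟩ ht.2.ne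
    have h2 : F j =ᶠ[𝓝 t] fun _ => 0 := by
      filter_upwards [isOpen_Ioo.mem_nhds ht] with x hx using ih (by omega) x hx
    exact h1.unique ((hasDerivAt_const t (0 : ℝ)).congr_of_eventuallyEq h2)

theorem eq_zero_right_of_eq_zero (h : IsJumpSpline n a b s l F) {q : ℕ}
    (h0 : ∀ t ∈ Ioo s b, F q t = 0) :
    ∀ j, q ≤ j → j + 1 ≤ n → ∀ t ∈ Ioo s b, F j t = 0 := by
  intro j hqj
  induction j, hqj using Nat.le_induction with
  | base => exact fun _ => h0
  | succ j hqj ih =>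
    intro hj t ht
    have h1 := h.deriv j (by omega) t ⟨h.knot.1.trans ht.1, ht.2⟩ ht.1.ne'
    have h2 : F j =ᶠ[𝓝 t] fun _ => 0 := by
      filter_upwards [isOpen_Ioo.mem_nhds ht] with x hx using ih (by omega) x hx
    exact h1.unique ((hasDerivAt_const t (0 : ℝ)).congr_of_eventuallyEq h2)

/-- If `F q` vanished on all of `(a, s)`, then `l = 0` and, by continuity, the orders `q, …, n - 2`
vanish at the knot. All these derivatives and that of order `n - 1` would then be positive at `b`,
against the condition there. -/
theorem countable_zeros_left (h : IsJumpSpline n a b s l F) {q i : ℕ} (hq : q + 2 ≤ n)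
    (hqi : q ≤ i) (hi : i < n) (hib : F i b = 0) : {t ∈ Ioo a s | F q t = 0}.Countable := by
  have hn := h.two_le
  rcases eq_zero_or_countable (F := F) (x := a) (y := s) (c := l) (q := q) (n - 1) (by omega)
    (fun j _ hj t ht => h.deriv j (by omega) t ⟨ht.1, ht.2.trans h.knot.2⟩ ht.2.ne)
    (fun t ht => h.left t ⟨ht.1.le, ht.2⟩) with h0 | h0
  · exfalso
    have h1 := h.eq_zero_left_of_eq_zero h0
    obtain ⟨t, ht⟩ := exists_between h.knot.1
    have hl : l = 0 := by
      rw [← h.left t ⟨ht.1.le, ht.2⟩]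
      exact h1 (n - 1) (by omega) (by omega) t ht
    have hs : ∀ j, q ≤ j → j + 2 ≤ n → F j s = 0 := by
      intro j hqj hj
      have h2 : Tendsto (F j) (𝓝[Ioo a s] s) (𝓝 (F j s)) :=
        (h.cont j hj s (Ioo_subset_Icc_self h.knot)).mono_left (nhdsWithin_mono _
          (Ioo_subset_Icc_self.trans (Icc_subset_Icc le_rfl h.knot.2.le)))
      have : (𝓝[Ioo a s] s).NeBot := right_nhdsWithin_Ioo_neBot h.knot.1
      refine tendsto_nhds_unique_of_eventuallyEq h2 (tendsto_const_nhds (x := (0 : ℝ))) ?_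
      filter_upwards [self_mem_nhdsWithin] with x hx using h1 j hqj (by omega) x hx
    have := h.pos_right hl hs i hqi (by omega) b ⟨h.knot.2, le_rfl⟩
    linarith
  · exact h0

theorem countable_zeros_right (h : IsJumpSpline n a b s l F) {q i : ℕ} (hq : q + 2 ≤ n)
    (hqi : q ≤ i) (hi : i < n) (hia : F i a = 0) : {t ∈ Ioo s b | F q t = 0}.Countable := by
  have hn := h.two_le
  rcases eq_zero_or_countable (F := F) (x := s) (y := b) (c := l + 1) (q := q) (n - 1) (by omega)
    (fun j _ hj t ht => h.deriv j (by omega) t ⟨h.knot.1.trans ht.1, ht.2⟩ ht.1.ne')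
    (fun t ht => h.right t ⟨ht.1, ht.2.le⟩) with h0 | h0
  · exfalso
    have h1 := h.eq_zero_right_of_eq_zero h0
    obtain ⟨t, ht⟩ := exists_between h.knot.2
    have hl : l + 1 = 0 := by
      rw [← h.right t ⟨ht.1, ht.2.le⟩]
      exact h1 (n - 1) (by omega) (by omega) t ht
    have hs : ∀ j, q ≤ j → j + 2 ≤ n → F j s = 0 := by
      intro j hqj hj
      have h2 : Tendsto (F j) (𝓝[Ioo s b] s) (𝓝 (F j s)) :=
        (h.cont j hj s (Ioo_subset_Icc_self h.knot)).mono_left (nhdsWithin_mono _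
          (Ioo_subset_Icc_self.trans (Icc_subset_Icc h.knot.1.le le_rfl)))
      have : (𝓝[Ioo s b] s).NeBot := left_nhdsWithin_Ioo_neBot h.knot.2
      refine tendsto_nhds_unique_of_eventuallyEq h2 (tendsto_const_nhds (x := (0 : ℝ))) ?_
      filter_upwards [self_mem_nhdsWithin] with x hx using h1 j hqj (by omega) x hx
    have := h.pos_left hl hs i hqi (by omega) a ⟨le_rfl, h.knot.1⟩
    rw [hia, mul_zero] at this
    exact this.false
  · exact h0

theorem ae_ne_zero (h : IsJumpSpline n a b s l F) {q i i' : ℕ} (hq : q + 2 ≤ n)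
    (hqi : q ≤ i) (hi : i < n) (hia : F i a = 0) (hqi' : q ≤ i') (hi' : i' < n)
    (hib : F i' b = 0) : ∀ᵐ t ∂(volume.restrict (Ioo a b)), F q t ≠ 0 := by
  rw [ae_restrict_iff' measurableSet_Ioo]
  have hc := ((h.countable_zeros_left hq hqi' hi' hib).union
    (h.countable_zeros_right hq hqi hi hia)).union (countable_singleton s)
  filter_upwards [measure_eq_zero_iff_ae_notMem.1 (hc.measure_zero volume)] with t ht hab h0
  apply ht
  rcases lt_trichotomy t s with hts | hts | hts
  · exact Or.inl (Or.inl ⟨⟨hab.1, hts⟩, h0⟩)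
  · exact Or.inr hts
  · exact Or.inl (Or.inr ⟨⟨hts, hab.2⟩, h0⟩)

/-- The derivatives of a jump spline, continued by the step function and the constant `1`. -/
noncomputable def chain (n : ℕ) (s l : ℝ) (F : ℕ → ℝ → ℝ) (j : ℕ) : ℝ → ℝ :=
  if j + 2 ≤ n then F j else if j + 1 = n then fun t => if t ≤ s then l else l + 1 else fun _ => 1

/-- The value of `F (n - 1)` at the knot is not controlled, so a genuine step function takes its
place. It is monotone because the jump is `+1`. -/
theorem hasSlope_chain (h : IsJumpSpline n a b s l F) {j : ℕ} (hj : j < n) :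
    HasSlope a b (chain n s l F j) (chain n s l F (j + 1)) := by
  by_cases h1 : j + 2 ≤ n
  · have hj0 : chain n s l F j = F j := by simp [chain, h1]
    rw [hj0]
    refine hasSlope_of_hasDerivAt (s := s) (h.cont j h1) fun t ht hts => ?_
    convert h.deriv j h1 t ht hts using 1
    by_cases h2 : j + 1 + 2 ≤ n
    · simp [chain, h2]
    · have h3 : j + 1 + 1 = n := by omega
      simp only [chain, h2, h3, if_false, if_true]
      rw [show j + 1 = n - 1 by omega]
      split_ifs with h4
      · exact (h.left t ⟨ht.1.le, lt_of_le_of_ne h4 hts⟩).symm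
      · exact (h.right t ⟨not_le.1 h4, ht.2.le⟩).symm
  · have h2 : j + 1 = n := by omega
    have h3 : chain n s l F (j + 1) = fun _ => 1 := by
      have h4 : ¬ j + 1 + 2 ≤ n := by omega
      have h5 : ¬ j + 1 + 1 = n := by omega
      simp only [chain, h4, h5, if_false]
    rw [h3]
    refine Monotone.hasSlope ?_ a b
    simp only [chain, h1, h2, if_false, if_true]
    intro x y hxy
    dsimp only
    split_ifs with h6 h7
    · rfl
    · linarith
    · exact absurd (hxy.trans ‹_›) h6
    · rfl

theorem chain_left (h : IsJumpSpline n a b s l F) {j : ℕ} (hj : j < n) :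
    chain n s l F j a = F j a := by
  by_cases h1 : j + 2 ≤ n
  · simp [chain, h1]
  · have h2 : j + 1 = n := by omega
    simp only [chain, h1, h2, if_false, if_true, h.knot.1.le]
    rw [show j = n - 1 by omega, h.left a ⟨le_rfl, h.knot.1⟩]

theorem chain_right (h : IsJumpSpline n a b s l F) {j : ℕ} (hj : j < n) :
    chain n s l F j b = F j b := by
  by_cases h1 : j + 2 ≤ n
  · simp [chain, h1]
  · have h2 : j + 1 = n := by omega
    simp only [chain, h1, h2, if_false, if_true, not_le.2 h.knot.2]
    rw [show j = n - 1 by omega, h.right b ⟨h.knot.2, le_rfl⟩]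

/-- Runs the count up to order `n`, where the chain is the constant `1` and its signs are known. -/
theorem alternates_one (h : IsJumpSpline n a b s l F) {q : ℕ} (hq : q + 2 ≤ n) {A B : Finset ℕ}
    (hA : ∀ j ∈ A, q ≤ j → j < n → F j a = 0) (hB : ∀ j ∈ B, q ≤ j → j < n → F j b = 0)
    (hcount : ∀ h, q ≤ h → h < n → h ≤ q + countIco A q h + countIco B q h)
    {e t : ℝ} (ht : t ∈ Ioo a b) (het : 0 < e * F q t) :
    Alternates (fun _ => 1) a (1 + q + countIco A q n + countIco B q n - n)
      (e * (-1) ^ countIco B q n) b := by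
  have h1 := alternates_chain (F := chain n s l F) (A := A) (B := B) (e := e)
    (fun j _ hj => h.hasSlope_chain hj)
    (fun j hj hqj hjn => by rw [h.chain_left hjn, hA j hj hqj hjn])
    (fun j hj hqj hjn => by rw [h.chain_right hjn, hB j hj hqj hjn]) hcount ht
    (by simpa [chain, hq] using het) (show q ≤ n by omega) le_rfl
  have h2 : chain n s l F n = fun _ => 1 := by
    simp [chain]
  rwa [h2] at h1

/-- The sign of a jump spline satisfying as many boundary conditions as its order. -/
theorem sign_mul_pos (h : IsJumpSpline n a b s l F) {q : ℕ} (hq : q + 2 ≤ n) {A B : Finset ℕ}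
    (hA : ∀ j ∈ A, q ≤ j → j < n → F j a = 0) (hB : ∀ j ∈ B, q ≤ j → j < n → F j b = 0)
    (hcount : ∀ h, q ≤ h → h < n → h ≤ q + countIco A q h + countIco B q h)
    (htot : q + countIco A q n + countIco B q n = n)
    {t : ℝ} (ht : t ∈ Ioo a b) (h0 : F q t ≠ 0) : 0 < (-1) ^ countIco B q n * F q t := by
  -- Taking `F q t` itself as the sign `e` treats both signs at once.
  have h1 := h.alternates_one hq hA hB hcount ht (e := F q t) (mul_self_pos.2 h0)
  rw [show 1 + q + countIco A q n + countIco B q n - n = 0 + 1 by omega] at h1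
  obtain ⟨_, _, h2, _⟩ := h1
  rwa [mul_one, mul_comm] at h2

/-- A jump spline cannot satisfy more boundary conditions than its order. -/
theorem eq_zero_of_extra_condition (h : IsJumpSpline n a b s l F) {q : ℕ} (hq : q + 2 ≤ n)
    {A B : Finset ℕ}
    (hA : ∀ j ∈ A, q ≤ j → j < n → F j a = 0) (hB : ∀ j ∈ B, q ≤ j → j < n → F j b = 0)
    (hcount : ∀ h, q ≤ h → h < n → h ≤ q + countIco A q h + countIco B q h)
    (htot : q + countIco A q n + countIco B q n = n + 1)
    {t : ℝ} (ht : t ∈ Ioo a b) : F q t = 0 := by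
  by_contra h0
  have h1 := h.alternates_one hq hA hB hcount ht (e := F q t) (mul_self_pos.2 h0)
  rw [show 1 + q + countIco A q n + countIco B q n - n = 0 + 1 + 1 by omega] at h1
  -- Two alternations of the constant `1` make a number and its negative both positive.
  obtain ⟨_, _, h2, _, _, h3, _⟩ := h1
  linarith

/-- A further zero derivative at `a` could be added to `A`. The lower bounds in `hcount` survive,
the total becomes `n + 1`, and `F q` would vanish on `(a, b)`. -/
theorem left_derivative_ne_zero (h : IsJumpSpline n a b s l F) {q : ℕ} (hq : q + 2 ≤ n)
    {A B : Finset ℕ}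
    (hA : ∀ j ∈ A, q ≤ j → j < n → F j a = 0) (hB : ∀ j ∈ B, q ≤ j → j < n → F j b = 0)
    (hcount : ∀ h, q ≤ h → h < n → h ≤ q + countIco A q h + countIco B q h)
    (htot : q + countIco A q n + countIco B q n = n)
    {t : ℝ} (ht : t ∈ Ioo a b) (h0 : F q t ≠ 0) {i : ℕ} (hqi : q ≤ i) (hin : i < n)
    (hi : i ∉ A) : F i a ≠ 0 := by
  intro hia
  refine h0 (h.eq_zero_of_extra_condition hq (A := insert i A) (B := B) ?_ hB ?_ ?_ ht)
  · intro j hj hqj hjn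
    rcases Finset.mem_insert.1 hj with rfl | hj
    · exact hia
    · exact hA j hj hqj hjn
  · intro m hqm hmn
    have := hcount m hqm hmn
    rw [countIco_insert hi]
    omega
  · rw [countIco_insert hi, if_pos ⟨hqi, hin⟩]
    omega

theorem right_derivative_ne_zero (h : IsJumpSpline n a b s l F) {q : ℕ} (hq : q + 2 ≤ n)
    {A B : Finset ℕ}
    (hA : ∀ j ∈ A, q ≤ j → j < n → F j a = 0) (hB : ∀ j ∈ B, q ≤ j → j < n → F j b = 0)
    (hcount : ∀ h, q ≤ h → h < n → h ≤ q + countIco A q h + countIco B q h)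
    (htot : q + countIco A q n + countIco B q n = n)
    {t : ℝ} (ht : t ∈ Ioo a b) (h0 : F q t ≠ 0) {i : ℕ} (hqi : q ≤ i) (hin : i < n)
    (hi : i ∉ B) : F i b ≠ 0 := by
  intro hib
  refine h0 (h.eq_zero_of_extra_condition hq (A := A) (B := insert i B) hA ?_ ?_ ?_ ht)
  · intro j hj hqj hjn
    rcases Finset.mem_insert.1 hj with rfl | hj
    · exact hib
    · exact hB j hj hqj hjn
  · intro m hqm hmn
    have := hcount m hqm hmn
    rw [countIco_insert hi]
    omega
  · rw [countIco_insert hi, if_pos ⟨hqi, hin⟩]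
    omega

/-- This is the leading Taylor term at `a`, obtained by descending from order `q + α` with the mean
value theorem. Taking `c ≤ s` keeps away from the knot. -/
theorem exists_left_nhds_nonneg (h : IsJumpSpline n a b s l F) {q α : ℕ} (hα : q + α < n)
    (hz : ∀ i < α, F (q + i) a = 0) :
    ∃ c ∈ Ioc a s, ∀ t ∈ Ioo a c, 0 ≤ F (q + α) a * F q t := by
  set w := F (q + α) a with hw
  obtain ⟨c, hc, h1⟩ : ∃ c ∈ Ioc a s, ∀ t ∈ Ioo a c, 0 ≤ w * F (q + α) t := by
    by_cases h2 : q + α + 2 ≤ n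
    · by_cases hw0 : w = 0
      · exact ⟨s, ⟨h.knot.1, le_rfl⟩, fun t _ => by simp [hw0]⟩
      have hcont : Tendsto (fun t => w * F (q + α) t) (𝓝[>] a) (𝓝 (w * w)) := by
        refine Tendsto.const_mul w ?_
        have h3 := h.cont (q + α) h2 a ⟨le_rfl, (h.knot.1.trans h.knot.2).le⟩
        rw [← nhdsWithin_Ioo_eq_nhdsGT (h.knot.1.trans h.knot.2)]
        exact h3.mono_left (nhdsWithin_mono _ Ioo_subset_Icc_self)
      have h4 := hcont.eventually (lt_mem_nhds (mul_self_pos.2 hw0))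
      rw [eventually_iff, mem_nhdsGT_iff_exists_Ioo_subset' h.knot.1] at h4
      obtain ⟨u, hu, h5⟩ := h4
      exact ⟨min u s, ⟨lt_min hu h.knot.1, min_le_right _ _⟩, fun t ht =>
        le_of_lt (h5 ⟨ht.1, ht.2.trans_le (min_le_left _ _)⟩)⟩
    · refine ⟨s, ⟨h.knot.1, le_rfl⟩, fun t ht => ?_⟩
      have h3 : q + α = n - 1 := by omega
      rw [hw, h3, h.left a ⟨le_rfl, h.knot.1⟩, h.left t ⟨ht.1.le, ht.2⟩]
      exact mul_self_nonneg l
  refine ⟨c, hc, ?_⟩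
  have key : ∀ d i, i + d = α → ∀ t ∈ Ioo a c, 0 ≤ w * F (q + i) t := by
    intro d
    induction d with
    | zero => rintro i rfl; exact h1
    | succ d ih =>
      intro i hi t ht
      obtain ⟨τ, hτ, h2⟩ := h.exists_sub_eq_left (j := q + i) (by omega) le_rfl ht.1
        (ht.2.le.trans hc.2)
      have h3 := ih (i + 1) (by omega) τ ⟨hτ.1, hτ.2.trans ht.2⟩
      rw [hz i (by omega), sub_zero] at h2
      rw [h2, ← mul_assoc]
      exact mul_nonneg h3 (sub_pos.2 ht.1).le
  exact key α 0 (by omega)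

theorem exists_right_nhds_nonneg (h : IsJumpSpline n a b s l F) {q β : ℕ} (hβ : q + β < n)
    (hz : ∀ i < β, F (q + i) b = 0) :
    ∃ c ∈ Ico s b, ∀ t ∈ Ioo c b, 0 ≤ (-1) ^ β * F (q + β) b * F q t := by
  set w := F (q + β) b with hw
  obtain ⟨c, hc, h1⟩ : ∃ c ∈ Ico s b, ∀ t ∈ Ioo c b, 0 ≤ w * F (q + β) t := by
    by_cases h2 : q + β + 2 ≤ n
    · by_cases hw0 : w = 0
      · exact ⟨s, ⟨le_rfl, h.knot.2⟩, fun t _ => by simp [hw0]⟩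
      have hcont : Tendsto (fun t => w * F (q + β) t) (𝓝[<] b) (𝓝 (w * w)) := by
        refine Tendsto.const_mul w ?_
        have h3 := h.cont (q + β) h2 b ⟨(h.knot.1.trans h.knot.2).le, le_rfl⟩
        rw [← nhdsWithin_Ioo_eq_nhdsLT (h.knot.1.trans h.knot.2)]
        exact h3.mono_left (nhdsWithin_mono _ Ioo_subset_Icc_self)
      have h4 := hcont.eventually (lt_mem_nhds (mul_self_pos.2 hw0))
      rw [eventually_iff, mem_nhdsLT_iff_exists_Ioo_subset' h.knot.2] at h4
      obtain ⟨u, hu, h5⟩ := h4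
      exact ⟨max u s, ⟨le_max_right _ _, max_lt hu h.knot.2⟩, fun t ht =>
        le_of_lt (h5 ⟨(le_max_left _ _).trans_lt ht.1, ht.2⟩)⟩
    · refine ⟨s, ⟨le_rfl, h.knot.2⟩, fun t ht => ?_⟩
      have h3 : q + β = n - 1 := by omega
      rw [hw, h3, h.right b ⟨h.knot.2, le_rfl⟩, h.right t ⟨ht.1, ht.2.le⟩]
      exact mul_self_nonneg (l + 1)
  refine ⟨c, hc, ?_⟩
  have key : ∀ d i, i + d = β → ∀ t ∈ Ioo c b, 0 ≤ (-1) ^ d * w * F (q + i) t := by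
    intro d
    induction d with
    | zero => rintro i rfl; simpa using h1
    | succ d ih =>
      intro i hi t ht
      obtain ⟨τ, hτ, h2⟩ := h.exists_sub_eq_right (j := q + i) (by omega)
        (hc.1.trans ht.1.le) ht.2 le_rfl
      have h3 := ih (i + 1) (by omega) τ ⟨ht.1.trans hτ.1, hτ.2⟩
      rw [hz i (by omega), zero_sub] at h2
      -- Each descent integrates leftwards from `b` and so reverses the sign.
      have h4 : (-1) ^ (d + 1) * w * F (q + i) t
          = (-1) ^ d * w * F (q + i + 1) τ * (b - t) := by
        rw [mul_assoc _ _ (b - t), ← h2]; ring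
      rw [h4]
      exact mul_nonneg h3 (sub_pos.2 ht.2).le
  exact key β 0 (by omega)

theorem left_derivative_sign (h : IsJumpSpline n a b s l F) {q α : ℕ} (hα : q + α < n)
    (hz : ∀ i < α, F (q + i) a = 0) (hne : F (q + α) a ≠ 0) {D : ℝ}
    (hD : ∀ᵐ t ∂(volume.restrict (Ioo a b)), 0 < D * F q t) : 0 < D * F (q + α) a := by
  obtain ⟨c, hc, h1⟩ := h.exists_left_nhds_nonneg hα hz
  obtain ⟨t, ht, h2⟩ := exists_mem_Ioo_of_ae le_rfl hc.1 (hc.2.trans h.knot.2.le) hD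
  have h3 := h1 t ht
  have hDne : D ≠ 0 := fun h0 => by simp [h0] at h2
  refine lt_of_le_of_ne ?_ (mul_ne_zero hDne hne).symm
  by_contra! h4
  -- With `w = F (q + α) a`, the product of `D * F q t > 0` and `D * w < 0` is negative, yet it
  -- equals `D ^ 2 * (w * F q t) ≥ 0`.
  nlinarith [mul_neg_of_pos_of_neg h2 h4, mul_nonneg (sq_nonneg D) h3]

theorem right_derivative_sign (h : IsJumpSpline n a b s l F) {q β : ℕ} (hβ : q + β < n)
    (hz : ∀ i < β, F (q + i) b = 0) (hne : F (q + β) b ≠ 0) {D : ℝ}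
    (hD : ∀ᵐ t ∂(volume.restrict (Ioo a b)), 0 < D * F q t) :
    0 < D * ((-1) ^ β * F (q + β) b) := by
  obtain ⟨c, hc, h1⟩ := h.exists_right_nhds_nonneg hβ hz
  obtain ⟨t, ht, h2⟩ := exists_mem_Ioo_of_ae (h.knot.1.le.trans hc.1) hc.2 le_rfl hD
  have h3 := h1 t ht
  have hDne : D ≠ 0 := fun h0 => by simp [h0] at h2
  refine lt_of_le_of_ne ?_ (mul_ne_zero hDne (mul_ne_zero (by simp) hne)).symm
  by_contra! h4
  nlinarith [mul_neg_of_pos_of_neg h2 h4, mul_nonneg (sq_nonneg D) h3]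

end IsJumpSpline

/-! ### From Green's functions to splines -/

theorem iteratedDerivWithin_iteratedDerivWithin (f : ℝ → ℝ) (s : Set ℝ) (m j : ℕ) :
    iteratedDerivWithin m (iteratedDerivWithin j f s) s = iteratedDerivWithin (j + m) f s := by
  induction m with
  | zero => simp
  | succ m ih =>
    ext x
    rw [iteratedDerivWithin_succ, ih, ← add_assoc, iteratedDerivWithin_succ]

namespace IsGreenFunction

variable {n : ℕ} {σ ε : Finset ℕ} {a b s : ℝ} {g : ℝ → ℝ → ℝ}

theorem contDiffWithinAt_slice {M : ℝ} (h : IsGreenFunction n M σ ε a b g) (hs : s ∈ Ioo a b)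
    {t : ℝ} (ht : t ∈ Icc a b) (hts : t ≠ s) :
    ContDiffWithinAt ℝ (n : ℕ∞) (fun x => g x s) (Icc a b) t := by
  have hpair : ContDiff ℝ (n : ℕ∞) (fun x : ℝ => (x, s)) := contDiff_id.prodMk contDiff_const
  rcases lt_or_gt_of_ne hts with hlt | hlt
  · have h1 : ContDiffOn ℝ (n : ℕ∞) (fun x => g x s) (Ico a s) :=
      h.contDiffOn_upper.comp hpair.contDiffOn
        (fun x (hx : x ∈ Ico a s) => ⟨hx.1, hx.2, hs.2.le⟩)
    refine (h1 t ⟨ht.1, hlt⟩).mono_of_mem_nhdsWithin ?_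
    filter_upwards [self_mem_nhdsWithin, mem_nhdsWithin_of_mem_nhds (Iio_mem_nhds hlt)]
      with x hx hx' using ⟨hx.1, hx'⟩
  · have h1 : ContDiffOn ℝ (n : ℕ∞) (fun x => g x s) (Ioc s b) :=
      h.contDiffOn_lower.comp hpair.contDiffOn
        (fun x (hx : x ∈ Ioc s b) => ⟨hs.1.le, hx.1, hx.2⟩)
    refine (h1 t ⟨hlt, ht.2⟩).mono_of_mem_nhdsWithin ?_
    filter_upwards [self_mem_nhdsWithin, mem_nhdsWithin_of_mem_nhds (Ioi_mem_nhds hlt)]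
      with x hx hx' using ⟨hx', hx.2⟩

theorem hasDerivWithinAt_partialT {M : ℝ} (h : IsGreenFunction n M σ ε a b g) (hs : s ∈ Ioo a b)
    {t : ℝ} (ht : t ∈ Icc a b) (hts : t ≠ s) {j : ℕ} (hj : j < n) :
    HasDerivWithinAt (partialT a b g j s) (partialT a b g (j + 1) s t) (Icc a b) t := by
  have hu : UniqueDiffOn ℝ (Icc a b) := uniqueDiffOn_Icc (hs.1.trans hs.2)
  have h1 := (h.contDiffWithinAt_slice hs ht hts).differentiableWithinAt_iteratedDerivWithin
    (m := j) (by exact_mod_cast hj) (by rwa [insert_eq_of_mem ht])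
  have h2 := h1.hasDerivWithinAt
  rwa [← iteratedDerivWithin_succ] at h2

/-- For `M = 0` the derivative of order `n - 1` is constant on each side of `s`; the one-sided
limits in `jump` identify the two constants. -/
theorem exists_isJumpSpline (hn : 2 ≤ n) (h : IsGreenFunction n 0 σ ε a b g) (hs : s ∈ Ioo a b) :
    ∃ l, IsJumpSpline n a b s l (fun j => partialT a b g j s) := by
  have hu : UniqueDiffOn ℝ (Icc a b) := uniqueDiffOn_Icc (hs.1.trans hs.2)
  obtain ⟨l, hl1, hl2⟩ := h.jump s hs
  have hder : ∀ t ∈ Icc a b, t ≠ s →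
      HasDerivWithinAt (partialT a b g (n - 1) s) 0 (Icc a b) t := by
    intro t ht hts
    have h1 := h.hasDerivWithinAt_partialT hs ht hts (j := n - 1) (by omega)
    have h2 := h.equation s hs t ht hts
    rw [zero_mul, add_zero] at h2
    rwa [show n - 1 + 1 = n by omega, h2] at h1
  have hconst : ∀ x y, a ≤ x → x < y → y ≤ b → s ∉ Icc x y →
      partialT a b g (n - 1) s x = partialT a b g (n - 1) s y := by
    intro x y hax hxy hyb hsxy
    obtain ⟨τ, hτ, h1⟩ := exists_hasDerivAt_eq_slope (partialT a b g (n - 1) s) (fun _ => 0) hxy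
      (fun t ht => (hder t ⟨hax.trans ht.1, ht.2.trans hyb⟩
        (fun h => hsxy (h ▸ ht))).continuousWithinAt.mono (Icc_subset_Icc hax hyb))
      (fun t ht => (hder t ⟨hax.trans ht.1.le, ht.2.le.trans hyb⟩
        (fun h => hsxy (h ▸ Ioo_subset_Icc_self ht))).hasDerivAt
          (Icc_mem_nhds (hax.trans_lt ht.1) (ht.2.trans_le hyb)))
    rw [eq_div_iff (by linarith)] at h1
    linarith
  have hleft : ∀ t ∈ Ico a s, partialT a b g (n - 1) s t = partialT a b g (n - 1) s a := by
    intro t ht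
    rcases ht.1.eq_or_lt with rfl | h1
    · rfl
    · exact (hconst a t le_rfl h1 (ht.2.trans hs.2).le (fun h2 => absurd h2.2 ht.2.not_ge)).symm
  have hright : ∀ t ∈ Ioc s b, partialT a b g (n - 1) s t = partialT a b g (n - 1) s b := by
    intro t ht
    rcases ht.2.eq_or_lt with rfl | h1
    · rfl
    · exact hconst t b (hs.1.trans ht.1).le h1 le_rfl (fun h2 => absurd h2.1 ht.1.not_ge)
  have hla : partialT a b g (n - 1) s a = l := by
    refine (tendsto_nhds_unique_of_eventuallyEq hl1 tendsto_const_nhds ?_).symm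
    filter_upwards [Ioo_mem_nhdsLT hs.1] with t ht using hleft t ⟨ht.1.le, ht.2⟩
  have hlb : partialT a b g (n - 1) s b = l + 1 := by
    refine (tendsto_nhds_unique_of_eventuallyEq hl2 tendsto_const_nhds ?_).symm
    filter_upwards [Ioo_mem_nhdsGT hs.2] with t ht using hright t ⟨ht.1, ht.2.le⟩
  refine ⟨l, hn, hs, ?_, ?_, fun t ht => (hleft t ht).trans hla,
    fun t ht => (hright t ht).trans hlb⟩
  · intro j hj
    have hpair : ContDiff ℝ ((n - 2 : ℕ) : ℕ∞) (fun x : ℝ => (x, s)) :=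
      contDiff_id.prodMk contDiff_const
    have h1 : ContDiffOn ℝ ((n - 2 : ℕ) : ℕ∞) (fun x => g x s) (Icc a b) :=
      h.contDiffOn_square.comp hpair.contDiffOn
        (fun x (hx : x ∈ Icc a b) => ⟨hx, Ioo_subset_Icc_self hs⟩)
    refine h1.continuousOn_iteratedDerivWithin ?_ hu
    have : j ≤ n - 2 := by omega
    exact_mod_cast this
  · intro j hj t ht hts
    exact (h.hasDerivWithinAt_partialT hs (Ioo_subset_Icc_self ht) hts (j := j)
      (by omega)).hasDerivAt (Icc_mem_nhds ht.1 ht.2)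

end IsGreenFunction

/-! ### Index sets -/

theorem countIco_zero_eq (S : Finset ℕ) (h : ℕ) :
    countIco S 0 h = (S.filter (fun j => j < h)).card := by
  simp [countIco]

theorem card_truncIndices (n q : ℕ) (S : Finset ℕ) :
    (truncIndices n q S).card = countIco S q n := by
  unfold truncIndices countIco
  refine Finset.card_bij (fun i _ => i + q) ?_ ?_ ?_
  · intro i hi
    simp only [Finset.mem_filter, Finset.mem_range] at hi ⊢
    exact ⟨hi.2, by omega, by omega⟩
  · intro i _ j _ hij
    exact Nat.add_right_cancel hij
  · intro j hj
    simp only [Finset.mem_filter] at hj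
    refine ⟨j - q, ?_, by omega⟩
    simp only [Finset.mem_filter, Finset.mem_range]
    exact ⟨by omega, by rw [Nat.sub_add_cancel hj.2.1]; exact hj.1⟩

theorem mem_cyclicIndices_of_lt {n q i : ℕ} {S : Finset ℕ} (hi : q + i < n) :
    i ∈ cyclicIndices n q S ↔ q + i ∈ S := by
  simp only [cyclicIndices, Finset.mem_filter, Finset.mem_range]
  rw [add_comm i q, Nat.mod_eq_of_lt hi]
  exact ⟨fun h => h.2, fun h => ⟨by omega, h⟩⟩

/-- With fewer than `n - q` conditions of order in `[q, n)`, some order in that range is free. The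
least missing index therefore occurs before the cyclic shift wraps around. -/
theorem leastMissing_cyclicIndices {n q : ℕ} {S : Finset ℕ} (hS : countIco S q n < n - q) :
    q + leastMissing n (cyclicIndices n q S) < n ∧
    q + leastMissing n (cyclicIndices n q S) ∉ S ∧
    ∀ i < leastMissing n (cyclicIndices n q S), q + i ∈ S := by
  obtain ⟨i, hi, hiS⟩ : ∃ i, q + i < n ∧ q + i ∉ S := by
    by_contra! hcon
    rw [← card_truncIndices] at hS
    have : truncIndices n q S = Finset.range (n - q) := by
      refine Finset.filter_true_of_mem fun i hi => ?_
      rw [Finset.mem_range] at hi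
      rw [add_comm]
      exact hcon i (by omega)
    rw [this, Finset.card_range] at hS
    exact hS.false
  have hmem : i ∈ {i : ℕ | i < n ∧ i ∉ cyclicIndices n q S} :=
    ⟨by omega, fun h => hiS ((mem_cyclicIndices_of_lt hi).1 h)⟩
  have hle : leastMissing n (cyclicIndices n q S) ≤ i := Nat.sInf_le hmem
  have hinf : leastMissing n (cyclicIndices n q S) ∈
    {i : ℕ | i < n ∧ i ∉ cyclicIndices n q S} := Nat.sInf_mem ⟨i, hmem⟩
  have hlt : q + leastMissing n (cyclicIndices n q S) < n := by omega
  refine ⟨hlt, fun h => hinf.2 ((mem_cyclicIndices_of_lt hlt).2 h), fun j hj => ?_⟩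
  by_contra hjS
  have hj' : j ∈ {i : ℕ | i < n ∧ i ∉ cyclicIndices n q S} :=
    ⟨by omega, fun h => hjS ((mem_cyclicIndices_of_lt (by omega)).1 h)⟩
  exact absurd (Nat.sInf_le hj') (not_le.2 hj)

theorem exists_mem_of_countIco_pos {S : Finset ℕ} {q n : ℕ} (h : 1 ≤ countIco S q n) :
    ∃ i ∈ S, q ≤ i ∧ i < n := by
  obtain ⟨i, hi⟩ := Finset.card_pos.1 h
  exact ⟨i, (Finset.mem_filter.1 hi).1, (Finset.mem_filter.1 hi).2⟩

theorem mem_of_countIco_eq {S : Finset ℕ} {q n : ℕ} (h : countIco S q n = n - q) {i : ℕ}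
    (hqi : q ≤ i) (hin : i < n) : i ∈ S := by
  have h1 : S.filter (fun j => q ≤ j ∧ j < n) = Finset.Ico q n := by
    refine Finset.eq_of_subset_of_card_le (fun j hj => ?_) ?_
    · exact Finset.mem_Ico.2 (Finset.mem_filter.1 hj).2
    · rw [Nat.card_Ico]; exact h.ge
  have h2 : i ∈ S.filter (fun j => q ≤ j ∧ j < n) := h1 ▸ Finset.mem_Ico.2 ⟨hqi, hin⟩
  exact (Finset.mem_filter.1 h2).1

/-- The full set of signs in the strongly definite case, with `D = (-1) ^ d`. -/
theorem IsGreenFunction.signs {n q : ℕ} {σ ε : Finset ℕ} {a b : ℝ} {g : ℝ → ℝ → ℝ}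
    (h : IsGreenFunction n 0 σ ε a b g)
    (hcount : ∀ h, q ≤ h → h < n → h ≤ q + countIco σ q h + countIco ε q h)
    (htot : q + countIco σ q n + countIco ε q n = n)
    (hc : 1 ≤ countIco σ q n) (hd : 1 ≤ countIco ε q n) {s : ℝ} (hs : s ∈ Ioo a b) :
    (∀ᵐ t ∂(volume.restrict (Ioo a b)), 0 < (-1) ^ countIco ε q n * partialT a b g q s t) ∧
    0 < (-1) ^ countIco ε q n * iteratedDerivWithin (leastMissing n (cyclicIndices n q σ))
      (partialT a b g q s) (Icc a b) a ∧
    0 < (-1) ^ countIco ε q n * ((-1) ^ leastMissing n (cyclicIndices n q ε) *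
      iteratedDerivWithin (leastMissing n (cyclicIndices n q ε))
        (partialT a b g q s) (Icc a b) b) := by
  -- One condition at each end forces `q ≤ n - 2`, so `F q` is continuous across the knot.
  have hq2 : q + 2 ≤ n := by omega
  obtain ⟨l, hl⟩ := h.exists_isJumpSpline (by omega) hs
  set F : ℕ → ℝ → ℝ := fun j => partialT a b g j s with hF
  have hA : ∀ j ∈ σ, q ≤ j → j < n → F j a = 0 := fun j hj _ _ => h.boundary_left s hs j hj
  have hB : ∀ j ∈ ε, q ≤ j → j < n → F j b = 0 := fun j hj _ _ => h.boundary_right s hs j hj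
  obtain ⟨i, hi, hqi, hin⟩ := exists_mem_of_countIco_pos hc
  obtain ⟨i', hi', hqi', hin'⟩ := exists_mem_of_countIco_pos hd
  have hne := hl.ae_ne_zero hq2 hqi hin (hA i hi hqi hin) hqi' hin' (hB i' hi' hqi' hin')
  have hae : ∀ᵐ t ∂(volume.restrict (Ioo a b)), 0 < (-1) ^ countIco ε q n * F q t := by
    filter_upwards [hne, ae_restrict_mem measurableSet_Ioo] with t ht0 ht
    exact hl.sign_mul_pos hq2 hA hB hcount htot ht ht0
  obtain ⟨t, ht, ht0⟩ := exists_mem_Ioo_of_ae le_rfl (hs.1.trans hs.2) le_rfl hne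
  have hiter : ∀ m x, iteratedDerivWithin m (partialT a b g q s) (Icc a b) x = F (q + m) x := by
    intro m x
    exact congrFun (iteratedDerivWithin_iteratedDerivWithin (fun x => g x s) (Icc a b) m q) x
  obtain ⟨hα, hασ, hαz⟩ := leastMissing_cyclicIndices (n := n) (q := q) (S := σ) (by omega)
  obtain ⟨hβ, hβε, hβz⟩ := leastMissing_cyclicIndices (n := n) (q := q) (S := ε) (by omega)
  refine ⟨hae, ?_, ?_⟩
  · rw [hiter]
    exact hl.left_derivative_sign hα
      (fun i hi => hA _ (hαz i hi) (by omega) (by omega))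
      (hl.left_derivative_ne_zero hq2 hA hB hcount htot ht ht0 (by omega) hα hασ) hae
  · rw [hiter]
    exact hl.right_derivative_sign hβ
      (fun i hi => hB _ (hβz i hi) (by omega) (by omega))
      (hl.right_derivative_ne_zero hq2 hA hB hcount htot ht ht0 (by omega) hβ hβε) hae

/-! ### Existence of the Green's function -/

theorem hasDerivAt_max_zero_pow (k : ℕ) (x : ℝ) :
    HasDerivAt (fun y : ℝ => max y 0 ^ (k + 2)) ((k + 2) * max x 0 ^ (k + 1)) x := by
  rcases lt_trichotomy x 0 with hx | rfl | hx
  · have h1 : (fun y : ℝ => max y 0 ^ (k + 2)) =ᶠ[𝓝 x] fun _ => 0 := by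
      filter_upwards [Iio_mem_nhds hx] with y hy
      rw [max_eq_right (le_of_lt hy), zero_pow (by omega)]
    rw [max_eq_right hx.le, zero_pow (by omega), mul_zero]
    exact (hasDerivAt_const x (0 : ℝ)).congr_of_eventuallyEq h1
  · rw [max_self, zero_pow (by omega), mul_zero, hasDerivAt_iff_tendsto_slope]
    have h1 : ∀ y : ℝ, y ≠ 0 → max y 0 ^ (k + 1) = slope (fun y : ℝ => max y 0 ^ (k + 2)) 0 y := by
      intro y hy
      rw [slope_def_field, max_self, zero_pow (by omega), sub_zero, sub_zero, eq_div_iff hy]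
      rcases le_total y 0 with h | h
      · simp [max_eq_right h]
      · rw [max_eq_left h]; ring
    have h2 : Tendsto (fun y : ℝ => max y 0 ^ (k + 1)) (𝓝[≠] 0) (𝓝 0) := by
      have : Continuous (fun y : ℝ => max y 0 ^ (k + 1)) := by fun_prop
      have h3 := this.tendsto 0
      rw [max_self, zero_pow (by omega)] at h3
      exact h3.mono_left nhdsWithin_le_nhds
    refine h2.congr' ?_
    filter_upwards [self_mem_nhdsWithin] with y hy using h1 y hy
  · have h1 : (fun y : ℝ => max y 0 ^ (k + 2)) =ᶠ[𝓝 x] fun y => y ^ (k + 2) := by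
      filter_upwards [Ioi_mem_nhds hx] with y hy
      rw [max_eq_left (le_of_lt hy)]
    rw [max_eq_left hx.le]
    have := (hasDerivAt_pow (k + 2) x).congr_of_eventuallyEq h1
    push_cast at this
    exact this

/-- The truncated power of degree `k + 1` is of class `C^k`. -/
theorem contDiff_max_zero_pow (k : ℕ) : ContDiff ℝ (k : ℕ∞) (fun y : ℝ => max y 0 ^ (k + 1)) := by
  induction k with
  | zero =>
    refine contDiff_zero.2 ?_
    fun_prop
  | succ k ih =>
    have h1 : deriv (fun y : ℝ => max y 0 ^ (k + 1 + 1)) =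
        fun x => ((k : ℝ) + 2) * max x 0 ^ (k + 1) :=
      funext fun x => (hasDerivAt_max_zero_pow k x).deriv
    have h2 : ContDiff ℝ ((k : WithTop ℕ∞) + 1) (fun y : ℝ => max y 0 ^ (k + 1 + 1)) := by
      rw [contDiff_succ_iff_deriv]
      refine ⟨fun x => (hasDerivAt_max_zero_pow k x).differentiableAt, fun h => ?_, ?_⟩
      · exact absurd h (by simp)
      · rw [h1]
        exact contDiff_const.mul ih
    exact_mod_cast h2

open Polynomial in
theorem iteratedDeriv_eval (R : ℝ[X]) (j : ℕ) :
    iteratedDeriv j (fun x => R.eval x) = fun x => (derivative^[j] R).eval x := by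
  induction j with
  | zero => simp
  | succ j ih =>
    rw [iteratedDeriv_succ, ih, Function.iterate_succ_apply']
    funext x
    exact Polynomial.deriv _

open Polynomial in
theorem partialT_eq_eval {a b s t : ℝ} {g : ℝ → ℝ → ℝ} {R : ℝ[X]} (hab : a < b)
    (ht : t ∈ Icc a b) (h : (fun x => g x s) =ᶠ[𝓝 t] fun x => R.eval x) (j : ℕ) :
    partialT a b g j s t = (derivative^[j] R).eval t := by
  have h1 : iteratedDerivWithin j (fun x => g x s) (Icc a b) t =
      iteratedDerivWithin j (fun x => R.eval x) (Icc a b) t :=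
    (h.filter_mono nhdsWithin_le_nhds).iteratedDerivWithin_eq h.self_of_nhds
  rw [partialT, h1, iteratedDerivWithin_eq_iteratedDeriv (uniqueDiffOn_Icc hab)
    (by simpa using (Polynomial.contDiff_aeval R j (𝕜 := ℝ)).contDiffAt) ht, iteratedDeriv_eval]

open Polynomial in
/-- The homogeneous two-point boundary value problem for polynomials of degree `< n` has only the
trivial solution. -/
theorem polynomial_eq_zero_of_boundary {n : ℕ} {a b : ℝ} (hab : a < b) {σ ε : Finset ℕ}
    (hcount : ∀ h, h < n → h ≤ countIco σ 0 h + countIco ε 0 h)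
    (htot : countIco σ 0 n + countIco ε 0 n = n) {p : ℝ[X]} (hp : p.degree < n)
    (ha : ∀ i ∈ σ, (derivative^[i] p).eval a = 0) (hb : ∀ i ∈ ε, (derivative^[i] p).eval b = 0) :
    p = 0 := by
  by_contra h0
  obtain ⟨t, ht, ht0⟩ : ∃ t ∈ Ioo a b, p.eval t ≠ 0 := by
    by_contra! hcon
    exact h0 (Polynomial.eq_zero_of_infinite_isRoot p ((Ioo_infinite hab).mono hcon))
  have h1 := alternates_chain (a := a) (b := b) (F := fun j x => (derivative^[j] p).eval x)
    (q := 0) (m := n) (A := σ) (B := ε) (e := p.eval t) (t := t) (h := n)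
    (fun j _ _ => hasSlope_of_hasDerivAt (s := a) (Polynomial.continuous _).continuousOn
      (fun x _ _ => by
        rw [Function.iterate_succ_apply']
        exact Polynomial.hasDerivAt _ x))
    (fun j hj _ _ => ha j hj) (fun j hj _ _ => hb j hj)
    (fun h _ hn => by rw [zero_add]; exact hcount h hn) ht
    (mul_self_pos.2 ht0) (Nat.zero_le n) le_rfl
  rw [show 1 + 0 + countIco σ 0 n + countIco ε 0 n - n = 0 + 1 by omega] at h1
  obtain ⟨x, _, h2, _⟩ := h1
  -- The surviving alternation is a point where the derivative of order `n` is nonzero, but that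
  -- derivative is `0`.
  simp [Polynomial.iterate_derivative_eq_zero_of_degree_lt hp] at h2

open Polynomial in
/-- Solvability of the two-point boundary value problem for polynomials of degree `< n`. -/
theorem exists_polynomial_of_boundary {n : ℕ} {a b : ℝ} (hab : a < b) {σ ε : Finset ℕ}
    (hcount : ∀ h, h < n → h ≤ countIco σ 0 h + countIco ε 0 h)
    (htot : countIco σ 0 n + countIco ε 0 n = n) (hcard : σ.card + ε.card = n) (y : ℕ → ℝ) :
    ∃ p : ℝ[X], p.degree < n ∧ (∀ i ∈ σ, (derivative^[i] p).eval a = 0) ∧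
      ∀ i ∈ ε, (derivative^[i] p).eval b = y i := by
  let E (c : ℝ) (i : ℕ) : ℝ[X] →ₗ[ℝ] ℝ := Polynomial.leval c ∘ₗ (derivative (R := ℝ)) ^ i
  have hE : ∀ c i p, E c i p = (derivative^[i] p).eval c := by
    intro c i p
    simp [E, Module.End.pow_apply]
  let T : degreeLT ℝ n →ₗ[ℝ] (σ → ℝ) × (ε → ℝ) :=
    ((LinearMap.pi fun i : σ => E a i).prod (LinearMap.pi fun i : ε => E b i)) ∘ₗ
      (degreeLT ℝ n).subtype
  have hfd : FiniteDimensional ℝ (degreeLT ℝ n) :=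
    LinearEquiv.finiteDimensional (degreeLTEquiv ℝ n).symm
  have hrank : Module.finrank ℝ (degreeLT ℝ n) = Module.finrank ℝ ((σ → ℝ) × (ε → ℝ)) := by
    rw [(degreeLTEquiv ℝ n).finrank_eq]
    simp [hcard]
  have hinj : Function.Injective T := by
    rw [← LinearMap.ker_eq_bot, LinearMap.ker_eq_bot']
    rintro ⟨p, hp⟩ hT
    have hT1 := congrArg Prod.fst hT
    have hT2 := congrArg Prod.snd hT
    refine Subtype.ext (polynomial_eq_zero_of_boundary hab hcount htot (mem_degreeLT.1 hp) ?_ ?_)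
    · intro i hi
      rw [← hE]
      exact congrFun hT1 ⟨i, hi⟩
    · intro i hi
      rw [← hE]
      exact congrFun hT2 ⟨i, hi⟩
  -- There are as many conditions as coefficients, so uniqueness gives solvability.
  obtain ⟨⟨p, hp⟩, hT⟩ :=
    (LinearMap.injective_iff_surjective_of_finrank_eq_finrank hrank).1 hinj (0, fun i => y i)
  have hT1 := congrArg Prod.fst hT
  have hT2 := congrArg Prod.snd hT
  refine ⟨p, mem_degreeLT.1 hp, fun i hi => ?_, fun i hi => ?_⟩
  · rw [← hE]
    exact congrFun hT1 ⟨i, hi⟩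
  · rw [← hE]
    exact congrFun hT2 ⟨i, hi⟩

-- The truncated power `(t - s)_+^{n-1} / (n-1)!` has the right jump and vanishes near `a`.
-- Subtracting a polynomial in `t` that has zero data at `a` and the same data at `b` leaves the
-- jump intact and yields all boundary conditions.
open Polynomial in
theorem exists_isGreenFunction {n : ℕ} (hn : 2 ≤ n) {a b : ℝ} (hab : a < b) {σ ε : Finset ℕ}
    (hcount : ∀ h, h < n → h ≤ countIco σ 0 h + countIco ε 0 h)
    (htot : countIco σ 0 n + countIco ε 0 n = n) (hcard : σ.card + ε.card = n) :
    ∃ g : ℝ → ℝ → ℝ, IsGreenFunction n 0 σ ε a b g := by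
  -- `P i` is the cardinal solution with datum `1` at order `i` at `b`. It does not involve `s`, so
  -- the correction `p s` depends on `s` only through the polynomial coefficients `κ i s` and is
  -- jointly smooth.
  choose P hPdeg hPa hPb using fun i : ℕ =>
    exists_polynomial_of_boundary hab hcount htot hcard (fun j => if j = i then 1 else 0)
  set c : ℝ := ((n - 1).factorial : ℝ)⁻¹ with hc
  -- `κ i s` is the `i`-th derivative of the truncated power at `b`.
  set κ : ℕ → ℝ → ℝ := fun i s => c * ((n - 1).descFactorial i * (b - s) ^ (n - 1 - i)) with hκ
  set Q : ℝ → ℝ[X] := fun s => C c * (X - C s) ^ (n - 1) with hQ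
  set p : ℝ → ℝ[X] := fun s => ∑ i ∈ ε, C (κ i s) * P i with hp
  set G : ℝ → ℝ → ℝ := fun t s => c * max (t - s) 0 ^ (n - 1) - (p s).eval t with hG
  have hQder : ∀ s j, derivative^[j] (Q s) =
      C c * ((n - 1).descFactorial j • (X - C s) ^ (n - 1 - j)) := by
    intro s j
    rw [hQ]
    dsimp only
    rw [iterate_derivative_C_mul, iterate_derivative_X_sub_pow]
  have hpder : ∀ s j, derivative^[j] (p s) = ∑ i ∈ ε, C (κ i s) * derivative^[j] (P i) := by
    intro s j
    rw [hp]
    dsimp only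
    rw [iterate_derivative_sum]
    simp only [iterate_derivative_C_mul]
  have hQn : ∀ s, derivative^[n] (Q s) = 0 := by
    intro s
    rw [hQder, Nat.descFactorial_of_lt (by omega), zero_smul, mul_zero]
  have hpn : ∀ s, derivative^[n] (p s) = 0 := by
    intro s
    rw [hpder]
    refine Finset.sum_eq_zero fun i _ => ?_
    rw [iterate_derivative_eq_zero_of_degree_lt (hPdeg i), mul_zero]
  have hQ1 : ∀ s, derivative^[n - 1] (Q s) = 1 := by
    intro s
    rw [hQder, Nat.descFactorial_self, Nat.sub_self, pow_zero, nsmul_one, ← C_eq_natCast,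
      ← C_mul, hc, inv_mul_cancel₀ (by positivity), C_1]
  have hlow : ∀ s t, s < t → (fun x => G x s) =ᶠ[𝓝 t] fun x => (Q s - p s).eval x := by
    intro s t hst
    filter_upwards [Ioi_mem_nhds hst] with x hx
    have hx' : s < x := hx
    simp only [hG, hQ, eval_sub, eval_mul, eval_C, eval_pow, eval_X]
    rw [max_eq_left (by linarith)]
  have hup : ∀ s t, t < s → (fun x => G x s) =ᶠ[𝓝 t] fun x => (-p s).eval x := by
    intro s t hst
    filter_upwards [Iio_mem_nhds hst] with x hx
    have hx' : x < s := hx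
    simp only [hG, eval_neg]
    rw [max_eq_right (by linarith), zero_pow (by omega), mul_zero, zero_sub]
  have hlow' : ∀ s t j, t ∈ Icc a b → s < t →
      partialT a b G j s t = (derivative^[j] (Q s)).eval t - (derivative^[j] (p s)).eval t := by
    intro s t j ht hst
    rw [partialT_eq_eval hab ht (hlow s t hst), iterate_derivative_sub, eval_sub]
  have hup' : ∀ s t j, t ∈ Icc a b → t < s →
      partialT a b G j s t = -(derivative^[j] (p s)).eval t := by
    intro s t j ht hst
    rw [partialT_eq_eval hab ht (hup s t hst), iterate_derivative_neg, eval_neg]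
  have hpsmooth : ∀ m : ℕ∞, ContDiff ℝ m (fun z : ℝ × ℝ => (p z.2).eval z.1) := by
    intro m
    simp only [hp, eval_finsetSum, eval_mul, eval_C, hκ]
    refine ContDiff.sum fun i _ => ContDiff.mul ?_ ?_
    · fun_prop
    · have h1 : ContDiff ℝ m (fun x => (P i).eval x) := by
        simpa using Polynomial.contDiff_aeval (P i) m (𝕜 := ℝ)
      exact h1.comp contDiff_fst
  refine ⟨G, ?_, ?_, ?_, ?_, ?_, ?_, ?_⟩
  · refine ContDiff.contDiffOn (ContDiff.sub (contDiff_const.mul ?_) (hpsmooth _))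
    have h1 := contDiff_max_zero_pow (n - 2)
    rw [show n - 2 + 1 = n - 1 by omega] at h1
    exact h1.comp (contDiff_fst.sub contDiff_snd)
  · have h1 : ContDiff ℝ (n : ℕ∞) (fun z : ℝ × ℝ => c * (z.1 - z.2) ^ (n - 1) - (p z.2).eval z.1) :=
      ContDiff.sub (by fun_prop) (hpsmooth _)
    refine h1.contDiffOn.congr fun z hz => ?_
    simp only [hG]
    rw [max_eq_left (by linarith [hz.2.1])]
  · refine (hpsmooth _).neg.contDiffOn.congr fun z hz => ?_
    simp only [hG]
    rw [max_eq_right (by linarith [hz.2.1]), zero_pow (by omega), mul_zero, zero_sub]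
  · intro s _ t ht hts
    rcases lt_or_gt_of_ne hts with h | h
    · rw [hup' s t n ht h, hpn]; simp
    · rw [hlow' s t n ht h, hpn, hQn]; simp
  · intro s hs
    have hcont : Continuous fun t => (derivative^[n - 1] (p s)).eval t := Polynomial.continuous _
    refine ⟨-(derivative^[n - 1] (p s)).eval s, ?_, ?_⟩
    · refine ((hcont.neg.tendsto s).mono_left nhdsWithin_le_nhds).congr' ?_
      filter_upwards [Ioo_mem_nhdsLT hs.1] with t ht
      exact (hup' s t _ ⟨ht.1.le, (ht.2.trans hs.2).le⟩ ht.2).symm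
    · rw [neg_add_eq_sub]
      refine (((continuous_const.sub hcont).tendsto s).mono_left nhdsWithin_le_nhds).congr' ?_
      filter_upwards [Ioo_mem_nhdsGT hs.2] with t ht
      rw [hlow' s t _ ⟨(hs.1.trans ht.1).le, ht.2.le⟩ ht.1, hQ1, eval_one]
      rfl
  · intro s hs i hi
    rw [hup' s a i ⟨le_rfl, hab.le⟩ hs.1, hpder, eval_finsetSum, neg_eq_zero]
    refine Finset.sum_eq_zero fun j _ => ?_
    rw [eval_mul, hPa j i hi, mul_zero]
  · intro s hs i hi
    rw [hlow' s b i ⟨hab.le, le_rfl⟩ hs.2, hpder, eval_finsetSum, hQder, sub_eq_zero]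
    rw [Finset.sum_eq_single i]
    · rw [eval_mul (p := C (κ i s)), hPb i i hi, if_pos rfl]
      simp [hκ]
    · intro j _ hji
      rw [eval_mul, hPb j i hi, if_neg (Ne.symm hji), mul_zero]
    · exact fun h => absurd hi h

/-! ### The theorem -/

theorem mainTheorem7 (n k : ℕ) (hk1 : 1 ≤ k) (hkn : k ≤ n - 1) (a b : ℝ) (hab : a < b)
    (σ ε : Finset ℕ) (hσ : σ ⊆ Finset.range n) (hε : ε ⊆ Finset.range n)
    (hσk : σ.card = k) (hεk : ε.card = n - k) (hNa : PropertyNa n σ ε)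
    (q : ℕ) (hq1 : 1 ≤ q) (hqn : q ≤ n - 1)
    (hcd : (truncIndices n q σ).card + (truncIndices n q ε).card = n - q) :
    (∃ g : ℝ → ℝ → ℝ, IsGreenFunction n 0 σ ε a b g) ∧
    ∀ g : ℝ → ℝ → ℝ, IsGreenFunction n 0 σ ε a b g →
      (1 ≤ (truncIndices n q σ).card → 1 ≤ (truncIndices n q ε).card →
        (Even (n - q - (truncIndices n q σ).card) → StronglyPositive n σ ε a b g q) ∧
        (Odd (n - q - (truncIndices n q σ).card) → StronglyNegative n σ ε a b g q)) ∧
      ((truncIndices n q σ).card = n - q → (truncIndices n q ε).card = 0 →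
        ∀ s ∈ Ioo a b,
          (∀ h : ℕ, q ≤ h → h ≤ n - 1 → ∀ t ∈ Ioc s b, 0 < partialT a b g h s t) ∧
          (∀ h : ℕ, q ≤ h → h ≤ n - 2 → ∀ t ∈ Icc a s, partialT a b g h s t = 0) ∧
          (∀ t ∈ Ico a s, partialT a b g (n - 1) s t = 0)) ∧
      ((truncIndices n q σ).card = 0 → (truncIndices n q ε).card = n - q →
        ∀ s ∈ Ioo a b,
          (∀ l : ℕ, q = n - l → Even l → ∀ t ∈ Ico a s, 0 < partialT a b g q s t) ∧
          (∀ l : ℕ, q = n - l → Odd l → ∀ t ∈ Ico a s, partialT a b g q s t < 0) ∧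
          (∀ h : ℕ, q ≤ h → h ≤ n - 2 → ∀ t ∈ Icc s b, partialT a b g h s t = 0) ∧
          (∀ t ∈ Ioc s b, partialT a b g (n - 1) s t = 0)) := by
  have hn : 2 ≤ n := by omega
  have hσn : countIco σ 0 n = k := by
    rw [countIco_zero_eq, Finset.filter_true_of_mem fun j hj => Finset.mem_range.1 (hσ hj), hσk]
  have hεn : countIco ε 0 n = n - k := by
    rw [countIco_zero_eq, Finset.filter_true_of_mem fun j hj => Finset.mem_range.1 (hε hj), hεk]
  have hcount0 : ∀ h, h < n → h ≤ countIco σ 0 h + countIco ε 0 h := by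
    intro h hh
    rcases Nat.eq_zero_or_pos h with rfl | h1
    · exact Nat.zero_le _
    · rw [countIco_zero_eq, countIco_zero_eq]
      exact hNa h h1 (by omega)
  rw [card_truncIndices, card_truncIndices] at *
  have h1 := countIco_add σ (show q ≤ n by omega)
  have h2 := countIco_add ε (show q ≤ n by omega)
  -- Of the `n` conditions, `n - q` have order at least `q`, so exactly `q` have smaller order;
  -- subtract them from `(N_a)`.
  have hcount : ∀ h, q ≤ h → h < n → h ≤ q + countIco σ q h + countIco ε q h := by
    intro h hqh hh
    have h3 := countIco_add σ hqh
    have h4 := countIco_add ε hqh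
    have h5 := hcount0 h hh
    omega
  refine ⟨exists_isGreenFunction hn hab hcount0 (by omega) (by omega), fun g hg => ⟨?_, ?_, ?_⟩⟩
  · intro hc hd
    have hsigns := fun s (hs : s ∈ Ioo a b) => hg.signs hcount (by omega) hc hd hs
    have hexp : n - q - countIco σ q n = countIco ε q n := by omega
    rw [hexp]
    refine ⟨fun heven => ?_, fun hodd => ?_⟩
    · simp only [heven.neg_one_pow, one_mul] at hsigns
      exact ⟨fun s hs => (hsigns s hs).1,
        ae_restrict_of_forall_mem measurableSet_Ioo fun s hs => (hsigns s hs).2.1,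
        ae_restrict_of_forall_mem measurableSet_Ioo fun s hs => (hsigns s hs).2.2⟩
    · simp only [hodd.neg_one_pow, neg_mul, one_mul, Left.neg_pos_iff] at hsigns
      exact ⟨fun s hs => (hsigns s hs).1,
        ae_restrict_of_forall_mem measurableSet_Ioo fun s hs => (hsigns s hs).2.1,
        ae_restrict_of_forall_mem measurableSet_Ioo fun s hs => (hsigns s hs).2.2⟩
  · intro hc _ s hs
    obtain ⟨l, hl⟩ := hg.exists_isJumpSpline hn hs
    have hza : ∀ j, q ≤ j → j < n → partialT a b g j s a = 0 := fun j hqj hjn =>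
      hg.boundary_left s hs j (mem_of_countIco_eq hc hqj hjn)
    -- The order `n - 1` is among the conditions at `a`, and there that derivative equals `l`.
    have hl0 : l = 0 := by
      rw [← hl.left a ⟨le_rfl, hs.1⟩]
      exact hza (n - 1) (by omega) (by omega)
    have hz := hl.eq_zero_left (q := q) hl0 (fun j hqj hj => hza j hqj (by omega))
    refine ⟨fun h hqh hh => ?_, fun h hqh hh => hz h hqh (by omega),
      fun t ht => (hl.left t ht).trans hl0⟩
    exact hl.pos_right hl0 (fun j hqj hj => hz j hqj hj s ⟨hs.1.le, le_rfl⟩) h hqh (by omega)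
  · intro _ hd s hs
    obtain ⟨l, hl⟩ := hg.exists_isJumpSpline hn hs
    have hzb : ∀ j, q ≤ j → j < n → partialT a b g j s b = 0 := fun j hqj hjn =>
      hg.boundary_right s hs j (mem_of_countIco_eq hd hqj hjn)
    have hl0 : l + 1 = 0 := by
      rw [← hl.right b ⟨hs.2, le_rfl⟩]
      exact hzb (n - 1) (by omega) (by omega)
    have hz := hl.eq_zero_right (q := q) hl0 (fun j hqj hj => hzb j hqj (by omega))
    have hsign := hl.pos_left hl0 (fun j hqj hj => hz j hqj hj s ⟨le_rfl, hs.2.le⟩) q le_rfl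
      (by omega)
    refine ⟨fun m hm heven t ht => ?_, fun m hm hodd t ht => ?_,
      fun h hqh hh => hz h hqh (by omega), fun t ht => (hl.right t ht).trans hl0⟩
    · have h3 := hsign t ht
      -- Since `q ≥ 1`, the subtraction in `q = n - m` does not truncate.
      rwa [show n - q = m by omega, heven.neg_one_pow, one_mul] at h3
    · have h3 := hsign t ht
      rw [show n - q = m by omega, hodd.neg_one_pow, neg_one_mul] at h3
      exact neg_pos.1 h3
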